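/- Let $O$ be a complete discrete valuation ring with perfect residue field, $\pi$ a uniformizer, $K$ its field of fractions, and let $0<r<n$ be integers. For $0\le i\le n-1$ let $\Lambda_i\subset K^n$ be the free $O$-module with basis $e^i_j=\pi^{-1}e_j$ for $1\le j\le i$ and $e^i_j=e_j$ for $i<j\le n$, where $e_1,\dots,e_n$ is the canonical basis of $K^n$. For an $O$-scheme $S$ put $\Lambda_{i,S}=\Lambda_i\otimes_O\mathcal{O}_S$, and consider the maps $$\Lambda_{0,S}\to\Lambda_{1,S}\to\cdots\to\Lambda_{n-1,S}\xrightarrow{\ \pi\ }\Lambda_{0,S},$$ all but the last of which are induced by the inclusions, while the last one is induced by multiplication by $\pi$. Consider the functor which sends an $O$-scheme $S$ to the set of families $(\mathcal{F}_i)_{0\le i\le n-1}$ of $\mathcal{O}_S$-submodules $\mathcal{F}_i\subseteq\Lambda_{i,S}$ that are locally free of rank $r$ and Zariski-locally on $S$ direct summands, and such that the maps above carry $\mathcal{F}_i$ into $\mathcal{F}_{i+1}$ for $0\le i\le n-1$ (where $\mathcal{F}_n=\mathcal{F}_0$). This functor is representable; let the $O$-scheme $M^{\rm loc}$ (the standard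 local model) represent it. Let $\mu=(1^r,0^{n-r})\in\mathbb{Z}^n$, let $W=S_n$ act on $\mathbb{Z}^n$ by permuting the coordinates, and let $\omega=(\omega_0,\dots,\omega_{n-1})$ with $\omega_i=(1^i,0^{n-i})$ be the base alcove. An extreme alcove is an alcove of the form $x=(x_i)_i$ with $x_i=\omega_i+w(\mu)$ for all $i$, for some $w\in W$ (one writes $x\in W(\mu)$). Let $U_x\subseteq M^{\rm loc}$ be the open subset where, for all $i$, the quotient $\Lambda_i/\mathcal{F}_i$ (with $(\mathcal{F}_i)_i$ the universal family) is generated by those $e^i_j$ with $\omega_i(j)=x_i(j)$. Then for every extreme alcove $x$ there is an isomorphism of $O$-schemes $U_x\cong\mathbb{A}^{r(n-r)}_O$. In particular, $U_x$ is smooth over $O$. -/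

import Mathlib

open CategoryTheory AlgebraicGeometry Opposite

universe u

noncomputable section

namespace LocalModel

/-! ### Vectors of sections -/

/-- The restriction of a vector of functions on `V` to a smaller open subset `W`. -/
def res {S : Scheme.{u}} {n : ℕ} {W V : S.Opens} (h : W ≤ V) (s : Fin n → Γ(S, V)) :
    Fin n → Γ(S, W) :=
  fun j => (S.presheaf.map (homOfLE h).op).hom (s j)

/-- The pullback of a vector of functions on `W ⊆ S` along `f : T ⟶ S`, as a vector of functions
on an open subset `V` of `f⁻¹(W)`. -/
def pull {T S : Scheme.{u}} {n : ℕ} (f : T ⟶ S) (W : S.Opens) (V : T.Opens) (e : V ≤ f ⁻¹ᵁ W)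
    (s : Fin n → Γ(S, W)) : Fin n → Γ(T, V) :=
  fun j => (f.appLE W V e).hom (s j)

lemma res_self {S : Scheme.{u}} {n : ℕ} {V : S.Opens} (h : V ≤ V) (s : Fin n → Γ(S, V)) :
    res h s = s := by
  funext j
  simp [res]

lemma res_res {S : Scheme.{u}} {n : ℕ} {U V W : S.Opens} (h : V ≤ U) (h' : W ≤ V)
    (s : Fin n → Γ(S, U)) : res h' (res h s) = res (h'.trans h) s := by
  funext j
  simp only [res, ← CommRingCat.comp_apply, ← Functor.map_comp]
  rfl

lemma res_pull {T S : Scheme.{u}} {n : ℕ} (f : T ⟶ S) {W : S.Opens} {V V' : T.Opens}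
    (e : V ≤ f ⁻¹ᵁ W) (h : V' ≤ V) (s : Fin n → Γ(S, W)) :
    res h (pull f W V e s) = pull f W V' (h.trans e) s := by
  funext j
  simp only [res, pull, ← CommRingCat.comp_apply, Scheme.Hom.appLE_map]

lemma pull_res {T S : Scheme.{u}} {n : ℕ} (f : T ⟶ S) {W W' : S.Opens} {V : T.Opens}
    (h : W' ≤ W) (e : V ≤ f ⁻¹ᵁ W') (s : Fin n → Γ(S, W)) :
    pull f W' V e (res h s) = pull f W V (fun _ hx => h (e hx)) s := by
  funext j
  simp only [res, pull, ← CommRingCat.comp_apply, Scheme.Hom.map_appLE]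

lemma pull_pull {U T S : Scheme.{u}} {n : ℕ} (g : U ⟶ T) (f : T ⟶ S) {W : S.Opens}
    {V : T.Opens} {V' : U.Opens} (e : V ≤ f ⁻¹ᵁ W) (e' : V' ≤ g ⁻¹ᵁ V) (s : Fin n → Γ(S, W)) :
    pull g V V' e' (pull f W V e s) = pull (g ≫ f) W V' (fun _ hx => e (e' hx)) s := by
  funext j
  simp only [pull, ← CommRingCat.comp_apply, Scheme.Hom.appLE_comp_appLE]

lemma pull_id {S : Scheme.{u}} {n : ℕ} {W V : S.Opens} (e : V ≤ (𝟙 S) ⁻¹ᵁ W)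
    (s : Fin n → Γ(S, W)) : pull (𝟙 S) W V e s = res e s := by
  funext j
  simp only [pull, res, Scheme.Hom.appLE, Scheme.Hom.id_app]
  rfl

/-- Applying a ring homomorphism to the coordinates of vectors maps spans into spans. -/
lemma map_mem_span {A B : Type u} [CommRing A] [CommRing B] {n : ℕ} (φ : A →+* B)
    {X : Set (Fin n → A)} {Y : Set (Fin n → B)} (hXY : ∀ x ∈ X, (fun j => φ (x j)) ∈ Y)
    {s : Fin n → A} (hs : s ∈ Submodule.span A X) :
    (fun j => φ (s j)) ∈ Submodule.span B Y := by
  induction hs using Submodule.span_induction with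
  | mem x hx => exact Submodule.subset_span (hXY x hx)
  | zero =>
    have : (fun j => φ ((0 : Fin n → A) j)) = 0 := by funext j; simp
    rw [this]; exact Submodule.zero_mem _
  | add x y _ _ hx hy =>
    have : (fun j => φ ((x + y) j)) = (fun j => φ (x j)) + fun j => φ (y j) := by
      funext j; simp
    rw [this]; exact Submodule.add_mem _ hx hy
  | smul a x _ hx =>
    have : (fun j => φ ((a • x) j)) = φ a • fun j => φ (x j) := by funext j; simp
    rw [this]; exact Submodule.smul_mem _ _ hx

/-! ### Subsheaves of free modules -/

/-- A sheaf of `𝒪_S`-submodules of the free module `𝒪_S^n`. -/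
@[ext]
structure Subsheaf (S : Scheme.{u}) (n : ℕ) where
  /-- The sections over an open subset. -/
  sections : ∀ V : S.Opens, Submodule Γ(S, V) (Fin n → Γ(S, V))
  res_mem : ∀ {V W : S.Opens} (h : W ≤ V) {s : Fin n → Γ(S, V)},
    s ∈ sections V → res h s ∈ sections W
  mem_of_local : ∀ {V : S.Opens} {s : Fin n → Γ(S, V)},
    (∀ p ∈ V, ∃ (W : S.Opens) (h : W ≤ V), p ∈ W ∧ res h s ∈ sections W) → s ∈ sections V

/-- `F ⊆ 𝒪_S^n` is locally free of rank `r` and, locally on `S`, a direct summand: locally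
on `S` it is the image of a homomorphism `A : 𝒪^r ⟶ 𝒪^n` which has a retraction `C`. -/
def IsLocallySummand {S : Scheme.{u}} {n : ℕ} (r : ℕ) (F : Subsheaf S n) : Prop :=
  ∀ p : S, ∃ (W : S.Opens) (A : Matrix (Fin n) (Fin r) Γ(S, W))
    (C : Matrix (Fin r) (Fin n) Γ(S, W)), p ∈ W ∧ C * A = 1 ∧
      ∀ (V : S.Opens) (h : V ≤ W),
        F.sections V = LinearMap.range (A.map (S.presheaf.map (homOfLE h).op).hom).mulVecLin

/-- The submodule of `𝒪_T(V)^n` generated by the pullbacks of the sections of `F` on `W`. -/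
def pullSpan {T S : Scheme.{u}} {n : ℕ} (f : T ⟶ S) (F : Subsheaf S n)
    (W : S.Opens) (V : T.Opens) (e : V ≤ f ⁻¹ᵁ W) : Submodule Γ(T, V) (Fin n → Γ(T, V)) :=
  Submodule.span Γ(T, V) (pull f W V e '' (F.sections W : Set (Fin n → Γ(S, W))))

lemma res_mem_pullSpan {T S : Scheme.{u}} {n : ℕ} {f : T ⟶ S} {F : Subsheaf S n}
    {W W' : S.Opens} {V V' : T.Opens} {e : V ≤ f ⁻¹ᵁ W} (hW : W' ≤ W) (hV : V' ≤ V)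
    (e' : V' ≤ f ⁻¹ᵁ W') {s : Fin n → Γ(T, V)} (hs : s ∈ pullSpan f F W V e) :
    res hV s ∈ pullSpan f F W' V' e' := by
  refine map_mem_span (T.presheaf.map (homOfLE hV).op).hom ?_ hs
  rintro _ ⟨t, ht, rfl⟩
  refine ⟨res hW t, F.res_mem hW ht, ?_⟩
  rw [pull_res]
  exact (res_pull f e hV t).symm

/-- The subsheaf of `𝒪_T^n` generated by the pullback of `F ⊆ 𝒪_S^n` along `f : T ⟶ S`, i.e. the
image of `f^* F ⟶ f^* 𝒪_S^n = 𝒪_T^n`. -/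
def Subsheaf.pullback {T S : Scheme.{u}} {n : ℕ} (f : T ⟶ S) (F : Subsheaf S n) :
    Subsheaf T n where
  sections V :=
    { carrier := {s | ∀ p ∈ V, ∃ (W : S.Opens) (V' : T.Opens) (h : V' ≤ V) (e : V' ≤ f ⁻¹ᵁ W),
        p ∈ V' ∧ res h s ∈ pullSpan f F W V' e}
      zero_mem' := fun p hp => ⟨⊤, V, le_rfl, fun _ _ => trivial, hp, by
        have : res (le_refl V) (0 : Fin n → Γ(T, V)) = 0 := by rw [res_self]
        rw [this]; exact Submodule.zero_mem _⟩
      add_mem' := by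
        intro s t hs ht p hp
        obtain ⟨W₁, V₁, h₁, e₁, hp₁, hs₁⟩ := hs p hp
        obtain ⟨W₂, V₂, h₂, e₂, hp₂, hs₂⟩ := ht p hp
        have e : V₁ ⊓ V₂ ≤ f ⁻¹ᵁ (W₁ ⊓ W₂) := fun x hx => ⟨e₁ hx.1, e₂ hx.2⟩
        refine ⟨W₁ ⊓ W₂, V₁ ⊓ V₂, inf_le_left.trans h₁, e, ⟨hp₁, hp₂⟩, ?_⟩
        have k₁ := res_mem_pullSpan (inf_le_left : W₁ ⊓ W₂ ≤ W₁)
          (inf_le_left : V₁ ⊓ V₂ ≤ V₁) e hs₁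
        have k₂ := res_mem_pullSpan (inf_le_right : W₁ ⊓ W₂ ≤ W₂)
          (inf_le_right : V₁ ⊓ V₂ ≤ V₂) e hs₂
        rw [res_res] at k₁ k₂
        have : res (inf_le_left.trans h₁ : V₁ ⊓ V₂ ≤ V) (s + t) =
            res (inf_le_left.trans h₁ : V₁ ⊓ V₂ ≤ V) s +
              res (inf_le_right.trans h₂ : V₁ ⊓ V₂ ≤ V) t := by
          funext j; simp [res]
        rw [this]; exact Submodule.add_mem _ k₁ k₂
      smul_mem' := by
        intro a s hs p hp
        obtain ⟨W, V', h, e, hp', hs'⟩ := hs p hp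
        refine ⟨W, V', h, e, hp', ?_⟩
        have : res h (a • s) = (T.presheaf.map (homOfLE h).op).hom a • res h s := by
          funext j; simp [res]
        rw [this]; exact Submodule.smul_mem _ _ hs' }
  res_mem := by
    intro V V₁ h₁ s hs p hp
    obtain ⟨W, V', h, e, hp', hs'⟩ := hs p (h₁ hp)
    have e' : V' ⊓ V₁ ≤ f ⁻¹ᵁ W := inf_le_left.trans e
    refine ⟨W, V' ⊓ V₁, inf_le_right, e', ⟨hp', hp⟩, ?_⟩
    have k := res_mem_pullSpan le_rfl (inf_le_left : V' ⊓ V₁ ≤ V') e' hs'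
    rw [res_res] at k ⊢
    exact k
  mem_of_local := by
    intro V s hs p hp
    obtain ⟨V₁, h₁, hp₁, hs₁⟩ := hs p hp
    obtain ⟨W, V', h, e, hp', hs'⟩ := hs₁ p hp₁
    refine ⟨W, V', h.trans h₁, e, hp', ?_⟩
    rw [res_res] at hs'
    exact hs'

lemma Subsheaf.mem_pullback {T S : Scheme.{u}} {n : ℕ} {f : T ⟶ S} {F : Subsheaf S n}
    {V : T.Opens} {s : Fin n → Γ(T, V)} :
    s ∈ (F.pullback f).sections V ↔ ∀ p ∈ V, ∃ (W : S.Opens) (V' : T.Opens) (h : V' ≤ V)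
      (e : V' ≤ f ⁻¹ᵁ W), p ∈ V' ∧ res h s ∈ pullSpan f F W V' e := Iff.rfl

lemma Subsheaf.pullSpan_le {T S : Scheme.{u}} {n : ℕ} (f : T ⟶ S) (F : Subsheaf S n)
    {W : S.Opens} {V : T.Opens} (e : V ≤ f ⁻¹ᵁ W) :
    pullSpan f F W V e ≤ (F.pullback f).sections V := by
  intro s hs p hp
  exact ⟨W, V, le_rfl, e, hp, by rwa [res_self]⟩

lemma Subsheaf.pull_mem_pullback {T S : Scheme.{u}} {n : ℕ} (f : T ⟶ S) (F : Subsheaf S n)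
    {W : S.Opens} {V : T.Opens} (e : V ≤ f ⁻¹ᵁ W) {s : Fin n → Γ(S, W)}
    (hs : s ∈ F.sections W) : pull f W V e s ∈ (F.pullback f).sections V :=
  F.pullSpan_le f e (Submodule.subset_span ⟨s, hs, rfl⟩)

lemma Subsheaf.pullback_id {S : Scheme.{u}} {n : ℕ} (F : Subsheaf S n) :
    F.pullback (𝟙 S) = F := by
  ext V s
  constructor
  · intro hs
    refine F.mem_of_local fun p hp => ?_
    obtain ⟨W, V', h, e, hp', hs'⟩ := hs p hp
    refine ⟨V', h, hp', Submodule.span_le.2 ?_ hs'⟩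
    rintro _ ⟨t, ht, rfl⟩
    rw [pull_id]
    exact F.res_mem e ht
  · intro hs
    have := F.pull_mem_pullback (𝟙 S) (le_refl V) hs
    rwa [show pull (𝟙 S) V V (le_refl V) s = s from (pull_id _ s).trans (res_self _ s)] at this

lemma Subsheaf.pullback_comp {U T S : Scheme.{u}} {n : ℕ} (g : U ⟶ T) (f : T ⟶ S)
    (F : Subsheaf S n) : F.pullback (g ≫ f) = (F.pullback f).pullback g := by
  ext V s
  constructor
  · intro hs p hp
    obtain ⟨W, V', h, e, hp', hs'⟩ := hs p hp
    refine ⟨f ⁻¹ᵁ W, V', h, e, hp', Submodule.span_mono ?_ hs'⟩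
    rintro _ ⟨t, ht, rfl⟩
    exact ⟨pull f W _ le_rfl t, F.pull_mem_pullback f le_rfl ht, pull_pull g f le_rfl e t⟩
  · intro hs
    refine Subsheaf.mem_of_local _ fun p hp => ?_
    obtain ⟨W, V', h, e, hp', hs'⟩ := hs p hp
    refine ⟨V', h, hp', Submodule.span_le.2 ?_ hs'⟩
    rintro _ ⟨t, ht, rfl⟩ q hq
    obtain ⟨W₁, V₁, h₁, e₁, hq₁, ht₁⟩ := ht (g q) (e hq)
    have e₂ : V' ⊓ g ⁻¹ᵁ V₁ ≤ g ⁻¹ᵁ V₁ := inf_le_right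
    refine ⟨W₁, V' ⊓ g ⁻¹ᵁ V₁, inf_le_left, fun x hx => e₁ (e₂ hx), ⟨hq, hq₁⟩, ?_⟩
    have key : res (inf_le_left : V' ⊓ g ⁻¹ᵁ V₁ ≤ V') (pull g W V' e t) =
        pull g V₁ (V' ⊓ g ⁻¹ᵁ V₁) e₂ (res h₁ t) := by
      rw [res_pull, pull_res]
    rw [key]
    refine map_mem_span (g.appLE V₁ _ e₂).hom ?_ ht₁
    rintro _ ⟨t', ht', rfl⟩
    exact ⟨t', ht', (pull_pull g f e₁ e₂ t').symm⟩

/-- Two vectors of functions which agree locally are equal. -/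
lemma eq_of_local {S : Scheme.{u}} {n : ℕ} {V : S.Opens} {s t : Fin n → Γ(S, V)}
    (hst : ∀ p ∈ V, ∃ (W : S.Opens) (h : W ≤ V), p ∈ W ∧ res h s = res h t) : s = t := by
  funext j
  refine TopCat.Presheaf.section_ext S.sheaf V _ _ fun p hp => ?_
  obtain ⟨W, h, hpW, hW⟩ := hst p hp
  have := congrFun hW j
  simp only [res] at this
  have h2 := congrArg (S.presheaf.germ W p hpW) this
  exact (TopCat.Presheaf.germ_res_apply _ _ _ _ _).symm.trans
    (h2.trans (TopCat.Presheaf.germ_res_apply _ _ _ _ _))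

lemma mem_range_iff {A : Type u} [CommRing A] {n r : ℕ} {P : Matrix (Fin n) (Fin r) A}
    {C : Matrix (Fin r) (Fin n) A} (h : C * P = 1) (s : Fin n → A) :
    s ∈ LinearMap.range P.mulVecLin ↔ P.mulVec (C.mulVec s) = s := by
  constructor
  · rintro ⟨v, rfl⟩
    simp only [Matrix.mulVecLin_apply, Matrix.mulVec_mulVec, h, Matrix.mul_one]
  · intro hs
    exact ⟨_, hs⟩

lemma map_mulVec' {A B : Type u} [CommRing A] [CommRing B] {n m : ℕ} (φ : A →+* B)
    (P : Matrix (Fin n) (Fin m) A) (v : Fin m → A) :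
    (fun j => φ (P.mulVec v j)) = (P.map φ).mulVec (fun j => φ (v j)) := by
  funext j
  exact RingHom.map_mulVec φ P v j

lemma map_mul_eq_one {A B : Type u} [CommRing A] [CommRing B] {n r : ℕ} (φ : A →+* B)
    {P : Matrix (Fin n) (Fin r) A} {C : Matrix (Fin r) (Fin n) A} (h : C * P = 1) :
    C.map φ * P.map φ = 1 := by
  rw [← Matrix.map_mul, h, Matrix.map_one _ φ.map_zero φ.map_one]

lemma IsLocallySummand.pullback {T S : Scheme.{u}} {n r : ℕ} (f : T ⟶ S) {F : Subsheaf S n}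
    (hF : IsLocallySummand r F) : IsLocallySummand r (F.pullback f) := by
  intro p
  obtain ⟨W, A, C, hp, hCA, hW⟩ := hF (f p)
  let W' : T.Opens := f ⁻¹ᵁ W
  let φ : Γ(S, W) →+* Γ(T, W') := (f.appLE W W' le_rfl).hom
  have hφ := map_mul_eq_one φ hCA
  refine ⟨W', A.map φ, C.map φ, hp, hφ, fun V h => ?_⟩
  set ρ : Γ(T, W') →+* Γ(T, V) := (T.presheaf.map (homOfLE h).op).hom with hρ
  have hρφ := map_mul_eq_one ρ hφ
  apply le_antisymm
  · intro s hs
    rw [mem_range_iff hρφ]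
    refine eq_of_local fun q hq => ?_
    obtain ⟨W₀, V', h', e, hq', hs'⟩ := hs q hq
    refine ⟨V', h', hq', ?_⟩
    set σ : Γ(T, V) →+* Γ(T, V') := (T.presheaf.map (homOfLE h').op).hom with hσ
    have hσρφ := map_mul_eq_one σ hρφ
    have e' : V' ≤ f ⁻¹ᵁ (W₀ ⊓ W) := fun x hx => ⟨e hx, h (h' hx)⟩
    have k := res_mem_pullSpan (inf_le_left : W₀ ⊓ W ≤ W₀) (le_refl V') e' hs'
    rw [res_self] at k
    have k2 : res h' s ∈ LinearMap.range (((A.map φ).map ρ).map σ).mulVecLin := by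
      refine Submodule.span_le.2 ?_ k
      rintro _ ⟨t, ht, rfl⟩
      have ht' : t ∈ F.sections (W₀ ⊓ W) := ht
      rw [hW _ inf_le_right] at ht'
      obtain ⟨v, rfl⟩ := ht'
      refine ⟨pull f _ V' e' v, ?_⟩
      have := map_mulVec' (f.appLE (W₀ ⊓ W) V' e').hom
        (A.map (S.presheaf.map (homOfLE (inf_le_right : W₀ ⊓ W ≤ W)).op).hom) v
      simp only [Matrix.mulVecLin_apply]
      refine Eq.trans ?_ this.symm
      have hA : ((A.map φ).map ρ).map σ =
          (A.map (S.presheaf.map (homOfLE (inf_le_right : W₀ ⊓ W ≤ W)).op).hom).map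
            (f.appLE (W₀ ⊓ W) V' e').hom := by
        ext i j
        simp only [Matrix.map_apply, φ, ρ, σ, ← CommRingCat.comp_apply,
          Scheme.Hom.appLE_map, Scheme.Hom.map_appLE]
      rw [hA]
      rfl
    rw [mem_range_iff hσρφ] at k2
    have e1 := map_mulVec' σ ((A.map φ).map ρ) (((C.map φ).map ρ).mulVec s)
    have e2 := map_mulVec' σ ((C.map φ).map ρ) s
    have : res h' (((A.map φ).map ρ).mulVec (((C.map φ).map ρ).mulVec s)) =
        (((A.map φ).map ρ).map σ).mulVec ((((C.map φ).map ρ).map σ).mulVec (res h' s)) :=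
      e1.trans (by rw [e2]; rfl)
    rw [this]
    exact k2
  · rintro _ ⟨v, rfl⟩
    rw [Matrix.mulVecLin_apply, Matrix.mulVec_eq_sum]
    refine Submodule.sum_mem ((F.pullback f).sections V) fun k _ => ?_
    have hk : (fun j => A j k) ∈ F.sections W := by
      rw [hW W le_rfl]
      refine ⟨Pi.single k 1, ?_⟩
      rw [Matrix.mulVecLin_apply, Matrix.mulVec_single_one]
      exact res_self (S := S) (le_refl W) (fun j => A j k)
    have := F.pull_mem_pullback f (V := V) h hk
    rw [op_smul_eq_smul]
    refine Submodule.smul_mem ((F.pullback f).sections V) (v k) ?_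
    convert this using 1
    funext j
    simp only [Matrix.transpose_apply, Matrix.map_apply, φ, ρ, pull, ← CommRingCat.comp_apply,
      Scheme.Hom.appLE_map]

/-! ### The lattice chain -/

/-- The `j`-th vector `e^i_j` of the standard basis of the lattice `Λ_i ⊆ K^n` (everything is
indexed from `0`): it is `ϖ⁻¹ e_j` for `j < i`, and `e_j` for `j ≥ i`. -/
def latticeBasis {n : ℕ} {K : Type u} [Field K] (ϖ : K) (i j : Fin n) : Fin n → K :=
  Pi.single j (if j < i then ϖ⁻¹ else 1)

/-- The diagonal entries, in the bases `e^i` and `e^{i+1}`, of the `i`-th map of the chain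
`Λ_0 ⟶ Λ_1 ⟶ ⋯ ⟶ Λ_{n-1} ⟶ Λ_0`. All but the last map are inclusions; the last one is
multiplication by `ϖ`. -/
def transition {n : ℕ} {O : Type u} [CommRing O] (ϖ : O) (i j : Fin n) : O :=
  if j = i then ϖ else 1

/-- The maps `Λ_i ⟶ Λ_{i+1}` with `i < n - 1` are the inclusions. -/
lemma latticeBasis_eq_transition {n : ℕ} {O K : Type u} [CommRing O] [Field K] [Algebra O K]
    (ϖ : O) (hϖ : algebraMap O K ϖ ≠ 0) {i i' : Fin n} (hi : (i' : ℕ) = i + 1) (j : Fin n) :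
    latticeBasis (algebraMap O K ϖ) i j =
      transition ϖ i j • latticeBasis (algebraMap O K ϖ) i' j := by
  ext k
  rcases eq_or_ne k j with rfl | hk
  · simp only [latticeBasis, transition, Pi.single_eq_same, Pi.smul_apply, Fin.lt_def,
      Fin.ext_iff, Algebra.smul_def]
    split_ifs <;> first | omega | simp [hϖ]
  · simp [latticeBasis, hk]

/-- The last map `Λ_{n-1} ⟶ Λ_0` is multiplication by `ϖ`. -/
lemma smul_latticeBasis_eq_transition {n : ℕ} {O K : Type u} [CommRing O] [Field K] [Algebra O K]
    (ϖ : O) (hϖ : algebraMap O K ϖ ≠ 0) {i i' : Fin n} (hi : (i : ℕ) + 1 = n) (hi' : (i' : ℕ) = 0)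
    (j : Fin n) :
    ϖ • latticeBasis (algebraMap O K ϖ) i j =
      transition ϖ i j • latticeBasis (algebraMap O K ϖ) i' j := by
  ext k
  rcases eq_or_ne k j with rfl | hk
  · have := k.isLt
    simp only [latticeBasis, transition, Pi.single_eq_same, Pi.smul_apply, Fin.lt_def,
      Fin.ext_iff, Algebra.smul_def]
    split_ifs <;> first | omega | simp [hϖ]
  · simp [latticeBasis, hk]

/-! ### The functor defining the local model -/

lemma le_preimage_top {T S : Scheme.{u}} (f : T ⟶ S) (V : T.Opens) : V ≤ f ⁻¹ᵁ ⊤ :=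
  fun _ _ => trivial

/-- The structure map `O ⟶ Γ(S, V)` of an `O`-scheme `S`. -/
def scalar {O : Type u} [CommRing O] (S : Over (Spec (.of O))) (V : S.left.Opens) :
    O →+* Γ(S.left, V) :=
  ((Scheme.ΓSpecIso (.of O)).inv ≫ S.hom.appLE ⊤ V (le_preimage_top _ _)).hom

lemma appLE_scalar {O : Type u} [CommRing O] {T S : Over (Spec (.of O))} (f : T ⟶ S)
    (W : S.left.Opens) (V : T.left.Opens) (e : V ≤ f.left ⁻¹ᵁ W) (a : O) :
    (f.left.appLE W V e).hom (scalar S W a) = scalar T V a := by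
  have : (Scheme.ΓSpecIso (.of O)).inv ≫ S.hom.appLE ⊤ W (le_preimage_top _ _) ≫
      f.left.appLE W V e = (Scheme.ΓSpecIso (.of O)).inv ≫ T.hom.appLE ⊤ V (le_preimage_top _ _) := by
    simp only [Scheme.Hom.appLE_comp_appLE, Over.w]
  exact congrArg (fun φ => φ.hom a) this

lemma res_scalar {O : Type u} [CommRing O] (S : Over (Spec (.of O))) {W V : S.left.Opens}
    (h : W ≤ V) (a : O) :
    (S.left.presheaf.map (homOfLE h).op).hom (scalar S V a) = scalar S W a := by
  have : (Scheme.ΓSpecIso (.of O)).inv ≫ S.hom.appLE ⊤ V (le_preimage_top _ _) ≫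
      S.left.presheaf.map (homOfLE h).op =
        (Scheme.ΓSpecIso (.of O)).inv ≫ S.hom.appLE ⊤ W (le_preimage_top _ _) := by
    simp only [Scheme.Hom.appLE_map]
  exact congrArg (fun φ => φ.hom a) this

/-- The map `Λ_{i,S} ⟶ Λ_{i+1,S}` on sections over `V`, where both sides are identified with
`𝒪_S^n` by means of the standard bases. -/
def chainMap {O : Type u} [CommRing O] (ϖ : O) {n : ℕ} (S : Over (Spec (.of O)))
    (V : S.left.Opens) (i : Fin n) (s : Fin n → Γ(S.left, V)) : Fin n → Γ(S.left, V) :=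
  fun j => scalar S V (transition ϖ i j) * s j

/-- The `S`-valued points of the local model: subsheaves `F_i ⊆ Λ_{i,S}` (`0 ≤ i ≤ n - 1`), locally
free of rank `r` and locally direct summands, such that `Λ_{i,S} ⟶ Λ_{i+1,S}` maps `F_i` into
`F_{i+1}` for all `i` (indices modulo `n`). -/
@[ext]
structure Chain {O : Type u} [CommRing O] (ϖ : O) (n r : ℕ) (S : Over (Spec (.of O))) where
  /-- The submodules of the chain. -/
  F : Fin n → Subsheaf S.left n
  isLocallySummand : ∀ i, IsLocallySummand r (F i)
  map_mem : ∀ (i : Fin n) (V : S.left.Opens) (s : Fin n → Γ(S.left, V)),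
    s ∈ (F i).sections V → chainMap ϖ S V i s ∈ (F (finRotate n i)).sections V

/-- Pullback of chains along a morphism of `O`-schemes. -/
def Chain.pullback {O : Type u} [CommRing O] {ϖ : O} {n r : ℕ} {T S : Over (Spec (.of O))}
    (f : T ⟶ S) (c : Chain ϖ n r S) : Chain ϖ n r T where
  F i := (c.F i).pullback f.left
  isLocallySummand i := (c.isLocallySummand i).pullback f.left
  map_mem := by
    intro i V s hs p hp
    obtain ⟨W, V', h, e, hp', hs'⟩ := hs p hp
    refine ⟨W, V', h, e, hp', ?_⟩
    have h1 : res h (chainMap ϖ T V i s) = chainMap ϖ T V' i (res h s) := by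
      funext j
      simp only [res, chainMap, map_mul, res_scalar]
    rw [h1]
    generalize res h s = t at hs'
    unfold pullSpan at hs'
    induction hs' using Submodule.span_induction with
    | mem x hx =>
      obtain ⟨t, ht, rfl⟩ := hx
      refine Submodule.subset_span ⟨chainMap ϖ S W i t, c.map_mem i W t ht, ?_⟩
      funext j
      simp only [pull, chainMap, map_mul, appLE_scalar]
    | zero =>
      have : chainMap ϖ T V' i 0 = 0 := by funext j; simp [chainMap]
      rw [this]; exact Submodule.zero_mem _
    | add x y _ _ hx hy =>
      have : chainMap ϖ T V' i (x + y) = chainMap ϖ T V' i x + chainMap ϖ T V' i y := by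
        funext j; simp [chainMap, mul_add]
      rw [this]; exact Submodule.add_mem _ hx hy
    | smul a x _ hx =>
      have : chainMap ϖ T V' i (a • x) = a • chainMap ϖ T V' i x := by
        funext j; simp [chainMap, mul_left_comm]
      rw [this]; exact Submodule.smul_mem _ _ hx

/-- The functor on `O`-schemes which the standard local model for `μ = (1^r, 0^{n-r})` and the
complete lattice chain represents. -/
def localModel (O : Type u) [CommRing O] (ϖ : O) (n r : ℕ) :
    (Over (Spec (.of O)))ᵒᵖ ⥤ Type u where
  obj S := Chain ϖ n r S.unop
  map f := ↾(Chain.pullback f.unop)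
  map_id S := by
    ext : 1
    refine DFunLike.ext _ _ fun c => ?_
    refine Chain.ext (funext fun i => ?_)
    exact (c.F i).pullback_id
  map_comp f g := by
    ext : 1
    refine DFunLike.ext _ _ fun c => ?_
    refine Chain.ext (funext fun i => ?_)
    exact (c.F i).pullback_comp g.unop.left f.unop.left

/-! ### Alcoves and the open subsets `U_x` -/

/-- An (extended) alcove for `GL_n`: vectors `x_0 ≤ x_1 ≤ ⋯ ≤ x_{n-1} ≤ x_0 + (1, …, 1)` in `ℤ^n`
such that the sum of the entries increases by one in each step. -/
@[ext]
structure Alcove (n : ℕ) where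
  /-- The vertices of the alcove. -/
  vertex : Fin n → Fin n → ℤ
  mono : ∀ i k, i ≤ k → ∀ j, vertex i j ≤ vertex k j
  le_add_one : ∀ i k j, vertex k j ≤ vertex i j + 1
  sum_eq : ∀ i k, ∑ j, vertex k j - (k : ℕ) = ∑ j, vertex i j - (i : ℕ)

/-- The base alcove `ω`, with vertices `ω_i = (1^i, 0^{n-i})`. -/
def baseAlcove (n : ℕ) : Alcove n where
  vertex i j := if j < i then 1 else 0
  mono i k h j := by
    split_ifs <;> omega
  le_add_one i k j := by split_ifs <;> omega
  sum_eq i k := by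
    have h : ∀ i : Fin n, (Finset.univ.filter (fun j : Fin n => j < i)).card = (i : ℕ) := by
      intro i
      rw [← Fin.card_Iio i]
      congr 1
      ext j
      simp
    simp [h]

/-- Translation of an alcove by a vector in `ℤ^n`. -/
def Alcove.translate {n : ℕ} (v : Fin n → ℤ) (x : Alcove n) : Alcove n where
  vertex i j := x.vertex i j + v j
  mono i k h j := by have := x.mono i k h j; omega
  le_add_one i k j := by have := x.le_add_one i k j; omega
  sum_eq i k := by
    have := x.sum_eq i k
    simp only [Finset.sum_add_distrib]; omega

/-- The cocharacter `μ = (1^r, 0^{n-r})`. -/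
def mu (n r : ℕ) (j : Fin n) : ℤ := if (j : ℕ) < r then 1 else 0

/-- `x` is an extreme alcove, i.e. `x ∈ W(μ)`: it is the translate of the base alcove by `w(μ)` for
some `w` in the finite Weyl group `W`, the symmetric group. -/
def Alcove.IsExtreme {n : ℕ} (r : ℕ) (x : Alcove n) : Prop :=
  ∃ w : Equiv.Perm (Fin n), x = (baseAlcove n).translate (fun j => mu n r (w⁻¹ j))

/-- Given a chain over `S` and an alcove `x`, the open subset of points of `S` near which
all the quotients `Λ_i / F_i` are generated by those `e^i_j` with `ω_i(j) = x_i(j)`. -/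
def Chain.alcoveLocus {O : Type u} [CommRing O] {ϖ : O} {n r : ℕ} {S : Over (Spec (.of O))}
    (c : Chain ϖ n r S) (x : Alcove n) : S.left.Opens where
  carrier := {p | ∀ i : Fin n, ∃ W : S.left.Opens, p ∈ W ∧
    (c.F i).sections W ⊔ Submodule.span Γ(S.left, W)
      {v | ∃ j, (baseAlcove n).vertex i j = x.vertex i j ∧ v = Pi.single j 1} = ⊤}
  is_open' := by
    simp only [Set.ofPred_forall]
    refine isOpen_iInter_of_finite fun i => isOpen_iff_forall_mem_open.2 ?_
    rintro p ⟨W, hp, hW⟩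
    exact ⟨W, fun q hq => ⟨W, hq, hW⟩, W.isOpen, hp⟩

/-- The open subset `U_x` of a scheme `M` representing the local model functor: the
locus defined by `x` for the universal chain over `M`. -/
def openSubset {O : Type u} [CommRing O] {ϖ : O} {n r : ℕ} {M : Over (Spec (.of O))}
    (h : (localModel O ϖ n r).RepresentableBy M) (x : Alcove n) : M.left.Opens :=
  Chain.alcoveLocus (h.homEquiv (𝟙 M) : Chain ϖ n r M) x

end LocalModel

end

noncomputable section

namespace LocalModel

/-! ### Frames -/

/-! Near any point, some r × r minor of a matrix spanning F_i is invertible. Multiplying by the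
inverse of that minor gives a frame whose rows selected by an injection σ_i form the identity. Such
a frame is unique (`Subsheaf.IsFrame.unique`), so local frames glue. Chains that can be framed along
a given family σ = (σ_i) therefore amount to tuples of matrices satisfying the polynomial equations
`IsChart`, and these are represented by the affine scheme `chartScheme ϖ σ`. As σ varies, these
charts are open subfunctors that cover a Zariski sheaf, which gives representability.

For an extreme alcove, ω_i(j) = x_i(j) means w(μ)(j) = 0, a condition independent of i. Hence U_x is
the locus of a constant family σ (`Chain.alcoveLocus_eq_locus`). The transition maps are diagonal,
so the chart equations then decouple: for each row j and column k, the entries p_i = P_i(j, k)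
satisfy ϖ^[j = i] p_i = ϖ^[σ k = i] p_{i+1} around the cycle. For j outside the range of σ, each
relation with i ≠ j expresses p_i through p_{i+1}, so everything is determined by p_j. The relation
at i = j then holds automatically, because the exponents add up (`frameExponent_finRotate`). Powers
of ϖ are never cancelled, so this is valid over every O-algebra. The r(n - r) entries P_j(j, k) are
thus free coordinates, and `exists_locus_iso` converts this statement on functors of points into an
isomorphism with affine space. -/

/-- The restriction homomorphism `Γ(S, V) ⟶ Γ(S, W)`. -/
abbrev resHom {S : Scheme.{u}} {W V : S.Opens} (h : W ≤ V) : Γ(S, V) →+* Γ(S, W) :=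
  (S.presheaf.map (homOfLE h).op).hom

lemma resHom_resHom {S : Scheme.{u}} {U V W : S.Opens} (h : V ≤ U) (h' : W ≤ V) (a : Γ(S, U)) :
    resHom h' (resHom h a) = resHom (h'.trans h) a := by
  simp only [← CommRingCat.comp_apply, ← Functor.map_comp]
  rfl

lemma resHom_self {S : Scheme.{u}} {V : S.Opens} (h : V ≤ V) (a : Γ(S, V)) :
    resHom h a = a := by
  simp [resHom]

lemma map_resHom_resHom {S : Scheme.{u}} {m l : Type*} {U V W : S.Opens} (h : V ≤ U) (h' : W ≤ V)
    (A : Matrix m l Γ(S, U)) :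
    (A.map (resHom h)).map (resHom h') = A.map (resHom (h'.trans h)) := by
  ext i j
  exact resHom_resHom h h' _

lemma map_resHom_self {S : Scheme.{u}} {m l : Type*} {V : S.Opens} (h : V ≤ V)
    (A : Matrix m l Γ(S, V)) : A.map (resHom h) = A := by
  ext i j
  exact resHom_self h _

lemma res_mulVec {S : Scheme.{u}} {n m : ℕ} {V W : S.Opens} (h : W ≤ V)
    (P : Matrix (Fin n) (Fin m) Γ(S, V)) (v : Fin m → Γ(S, V)) :
    res h (P.mulVec v) = (P.map (resHom h)).mulVec (res h v) :=
  map_mulVec' (resHom h) P v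

/-- Over all open subsets of `W`, the subsheaf `F` is the column space of the matrix `A`. -/
def Subsheaf.IsRange {S : Scheme.{u}} {n r : ℕ} (F : Subsheaf S n) (W : S.Opens)
    (A : Matrix (Fin n) (Fin r) Γ(S, W)) : Prop :=
  ∀ (V : S.Opens) (h : V ≤ W), F.sections V = LinearMap.range (A.map (resHom h)).mulVecLin

lemma Subsheaf.IsRange.col_mem {S : Scheme.{u}} {n r : ℕ} {F : Subsheaf S n} {W : S.Opens}
    {A : Matrix (Fin n) (Fin r) Γ(S, W)} (hA : F.IsRange W A) (k : Fin r) :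
    (fun j => A j k) ∈ F.sections W := by
  rw [hA W le_rfl]
  refine ⟨Pi.single k 1, ?_⟩
  rw [Matrix.mulVecLin_apply, Matrix.mulVec_single_one]
  exact res_self (S := S) (le_refl W) (fun j => A j k)

lemma mulVec_mem {A : Type u} [CommRing A] {n r : ℕ} {N : Submodule A (Fin n → A)}
    {P : Matrix (Fin n) (Fin r) A} (hP : ∀ k, (fun j => P j k) ∈ N) (v : Fin r → A) :
    P.mulVec v ∈ N := by
  rw [Matrix.mulVec_eq_sum]
  refine Submodule.sum_mem _ fun k _ => ?_
  rw [op_smul_eq_smul]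
  exact Submodule.smul_mem _ _ (hP k)

/-- The matrix `P` is a frame of `F` over `W`, normalised by the condition that the rows selected
by `σ` form the identity matrix. -/
def Subsheaf.IsFrame {S : Scheme.{u}} {n r : ℕ} (F : Subsheaf S n) (σ : Fin r ↪ Fin n)
    (W : S.Opens) (P : Matrix (Fin n) (Fin r) Γ(S, W)) : Prop :=
  (∀ k, (fun j => P j k) ∈ F.sections W) ∧ P.submatrix σ id = 1

lemma Subsheaf.IsFrame.res {S : Scheme.{u}} {n r : ℕ} {F : Subsheaf S n} {σ : Fin r ↪ Fin n}
    {W V : S.Opens} {P : Matrix (Fin n) (Fin r) Γ(S, W)} (hP : F.IsFrame σ W P) (h : V ≤ W) :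
    F.IsFrame σ V (P.map (resHom h)) := by
  refine ⟨fun k => F.res_mem h (hP.1 k), ?_⟩
  rw [Matrix.submatrix_map, hP.2, Matrix.map_one _ (map_zero _) (map_one _)]

lemma Subsheaf.IsFrame.pullback {T S : Scheme.{u}} {n r : ℕ} {F : Subsheaf S n}
    {σ : Fin r ↪ Fin n} {W : S.Opens} {P : Matrix (Fin n) (Fin r) Γ(S, W)}
    (hP : F.IsFrame σ W P) (f : T ⟶ S) (V : T.Opens) (e : V ≤ f ⁻¹ᵁ W) :
    (F.pullback f).IsFrame σ V (P.map (f.appLE W V e).hom) := by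
  refine ⟨fun k => F.pull_mem_pullback f e (hP.1 k), ?_⟩
  rw [Matrix.submatrix_map, hP.2, Matrix.map_one _ (map_zero _) (map_one _)]

lemma mem_span_single_iff {A : Type u} [CommRing A] {n : ℕ} (J : Set (Fin n)) (s : Fin n → A) :
    s ∈ Submodule.span A {v : Fin n → A | ∃ j, j ∈ J ∧ v = Pi.single j 1} ↔
      ∀ k, k ∉ J → s k = 0 := by
  constructor
  · intro hs k hk
    induction hs using Submodule.span_induction with
    | mem x hx =>
      obtain ⟨j, hj, rfl⟩ := hx
      exact Pi.single_eq_of_ne (by rintro rfl; exact hk hj) _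
    | zero => rfl
    | add x y _ _ hx hy => simp [hx, hy]
    | smul a x _ hx => simp [hx]
  · intro hs
    have : s = ∑ j, s j • (Pi.single j 1 : Fin n → A) := by
      ext k; simp [Finset.sum_apply, Pi.single_apply]
    rw [this]
    refine Submodule.sum_mem _ fun j _ => ?_
    by_cases hj : j ∈ J
    · exact Submodule.smul_mem _ _ (Submodule.subset_span ⟨j, hj, rfl⟩)
    · rw [hs j hj, zero_smul]; exact Submodule.zero_mem _

/-- This translates the generation condition defining U_x into the existence of a normalised frame.
Decomposing the basis vector at σ k produces the k-th column; conversely, s - P (s ∘ σ) vanishes at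
the rows of σ, so it lies in the span of the remaining basis vectors. -/
lemma sup_span_eq_top_iff {A : Type u} [CommRing A] {n r : ℕ} (N : Submodule A (Fin n → A))
    (σ : Fin r ↪ Fin n) (J : Set (Fin n)) (hJ : ∀ j, j ∈ J ↔ j ∉ Set.range σ) :
    N ⊔ Submodule.span A {v : Fin n → A | ∃ j, j ∈ J ∧ v = Pi.single j 1} = ⊤ ↔
      ∃ P : Matrix (Fin n) (Fin r) A, (∀ k, (fun j => P j k) ∈ N) ∧ P.submatrix σ id = 1 := by
  constructor
  · intro h
    have : ∀ k : Fin r, ∃ v ∈ N, ∀ l, v (σ l) = if l = k then 1 else 0 := by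
      intro k
      have hk : (Pi.single (σ k) 1 : Fin n → A) ∈ (⊤ : Submodule A (Fin n → A)) := trivial
      rw [← h] at hk
      obtain ⟨v, hv, w, hw, hvw⟩ := Submodule.mem_sup.1 hk
      refine ⟨v, hv, fun l => ?_⟩
      have h0 := (mem_span_single_iff J w).1 hw (σ l) (by simp [hJ])
      have := congrFun hvw (σ l)
      simpa [h0, Pi.single_apply] using this
    choose v hv hv' using this
    refine ⟨Matrix.of fun j k => v k j, fun k => hv k, ?_⟩
    ext l k
    simp [hv', Matrix.one_apply]
  · rintro ⟨P, hP, hP'⟩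
    rw [eq_top_iff]
    intro s _
    refine Submodule.mem_sup.2 ⟨P.mulVec (s ∘ σ), mulVec_mem hP _, s - P.mulVec (s ∘ σ), ?_,
      add_sub_cancel _ _⟩
    rw [mem_span_single_iff]
    intro k hk
    rw [hJ, not_not] at hk
    obtain ⟨l, rfl⟩ := hk
    have : (P.mulVec (s ∘ σ)) ∘ σ = (P.submatrix σ id).mulVec (s ∘ σ) := rfl
    have h2 := congrFun this l
    rw [hP', Matrix.one_mulVec] at h2
    simp only [Function.comp] at h2
    exact sub_eq_zero.2 h2.symm

/-! ### Loci of normalised frames and invertible minors -/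

/-- The open subset over which `F` has, locally, a frame normalised along `σ`. -/
def Subsheaf.locus {S : Scheme.{u}} {n r : ℕ} (F : Subsheaf S n) (σ : Fin r ↪ Fin n) :
    S.Opens where
  carrier := {p | ∃ (W : S.Opens) (P : Matrix (Fin n) (Fin r) Γ(S, W)), p ∈ W ∧ F.IsFrame σ W P}
  is_open' := by
    refine isOpen_iff_forall_mem_open.2 ?_
    rintro p ⟨W, P, hp, hP⟩
    exact ⟨W, fun q hq => ⟨W, P, hq, hP⟩, W.isOpen, hp⟩

lemma Subsheaf.mem_locus {S : Scheme.{u}} {n r : ℕ} {F : Subsheaf S n} {σ : Fin r ↪ Fin n}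
    {p : S} : p ∈ F.locus σ ↔ ∃ (W : S.Opens) (P : Matrix (Fin n) (Fin r) Γ(S, W)),
      p ∈ W ∧ F.IsFrame σ W P := Iff.rfl

/-- Writing the columns of a frame as combinations of those of A gives a right inverse of the square
submatrix A_σ; conversely, A times the inverse of A_σ is a frame. -/
lemma Subsheaf.IsRange.exists_isFrame_iff {S : Scheme.{u}} {n r : ℕ} {F : Subsheaf S n}
    {W : S.Opens} {A : Matrix (Fin n) (Fin r) Γ(S, W)} (hA : F.IsRange W A) (σ : Fin r ↪ Fin n)
    (V : S.Opens) (h : V ≤ W) :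
    (∃ P, F.IsFrame σ V P) ↔ IsUnit (resHom h (A.submatrix σ id).det) := by
  have hdet : resHom h (A.submatrix σ id).det = ((A.map (resHom h)).submatrix σ id).det := by
    rw [RingHom.map_det, RingHom.mapMatrix_apply, Matrix.submatrix_map]
  rw [hdet, ← Matrix.isUnit_iff_isUnit_det]
  constructor
  · rintro ⟨P, hP, hP'⟩
    have : ∀ k, ∃ v, (A.map (resHom h)).mulVec v = fun j => P j k := fun k => by
      have := hP k
      rwa [hA V h] at this
    choose v hv using this
    refine IsUnit.of_mul_eq_one (Matrix.of fun l k => v k l) ?_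
    rw [← hP']
    ext l k
    exact congrFun (hv k) (σ l)
  · intro hu
    rw [Matrix.isUnit_iff_isUnit_det] at hu
    refine ⟨A.map (resHom h) * ((A.map (resHom h)).submatrix σ id)⁻¹, fun k => ?_, ?_⟩
    · rw [hA V h]
      exact ⟨fun l => ((A.map (resHom h)).submatrix σ id)⁻¹ l k, rfl⟩
    · rw [Matrix.submatrix_mul _ _ σ id id Function.bijective_id, Matrix.submatrix_id_id,
        Matrix.mul_nonsing_inv _ hu]

lemma Subsheaf.IsRange.mem_locus_iff {S : Scheme.{u}} {n r : ℕ} {F : Subsheaf S n}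
    {W : S.Opens} {A : Matrix (Fin n) (Fin r) Γ(S, W)} (hA : F.IsRange W A) (σ : Fin r ↪ Fin n)
    {p : S} (hp : p ∈ W) : p ∈ F.locus σ ↔ p ∈ S.basicOpen (A.submatrix σ id).det := by
  constructor
  · rintro ⟨V, P, hpV, hP⟩
    have := (hA.exists_isFrame_iff σ (V ⊓ W) inf_le_right).1 ⟨_, hP.res inf_le_left⟩
    have h2 := S.basicOpen_of_isUnit this
    rw [Scheme.basicOpen_res] at h2
    exact (h2.ge ⟨hpV, hp⟩ : p ∈ _ ⊓ _).2
  · intro h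
    obtain ⟨P, hP⟩ := (hA.exists_isFrame_iff σ _ (S.basicOpen_le _)).2
      (S.toRingedSpace.isUnit_res_basicOpen _)
    exact ⟨_, P, h, hP⟩

/-- The left inverse C turns membership in the column space into the equation A (C s) = s, which can
be tested locally. Without it, local coefficients of a section would have to be glued. -/
lemma Subsheaf.IsRange.pullback {T S : Scheme.{u}} {n r : ℕ} {F : Subsheaf S n} {W : S.Opens}
    {A : Matrix (Fin n) (Fin r) Γ(S, W)} {C : Matrix (Fin r) (Fin n) Γ(S, W)} (hCA : C * A = 1)
    (hA : F.IsRange W A) (f : T ⟶ S) (W' : T.Opens) (e : W' ≤ f ⁻¹ᵁ W) :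
    (F.pullback f).IsRange W' (A.map (f.appLE W W' e).hom) := by
  intro V h
  have hφ := map_mul_eq_one (f.appLE W W' e).hom hCA
  have hρφ := map_mul_eq_one (resHom h) hφ
  apply le_antisymm
  · intro s hs
    rw [mem_range_iff hρφ]
    refine eq_of_local fun q hq => ?_
    obtain ⟨W₀, V', h', e₀, hq', hs'⟩ := hs q hq
    refine ⟨V', h', hq', ?_⟩
    have hσρφ := map_mul_eq_one (resHom h') hρφ
    have e' : V' ≤ f ⁻¹ᵁ (W₀ ⊓ W) := fun x hx => ⟨e₀ hx, e (h (h' hx))⟩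
    have k := res_mem_pullSpan (inf_le_left : W₀ ⊓ W ≤ W₀) (le_refl V') e' hs'
    rw [res_self] at k
    have k2 : res h' s ∈
        LinearMap.range (((A.map (f.appLE W W' e).hom).map (resHom h)).map
          (resHom h')).mulVecLin := by
      refine Submodule.span_le.2 ?_ k
      rintro _ ⟨t, ht, rfl⟩
      have ht' : t ∈ F.sections (W₀ ⊓ W) := ht
      rw [hA _ inf_le_right] at ht'
      obtain ⟨v, rfl⟩ := ht'
      refine ⟨pull f _ V' e' v, ?_⟩
      simp only [Matrix.mulVecLin_apply]
      refine Eq.trans ?_ (map_mulVec' (f.appLE (W₀ ⊓ W) V' e').hom _ v).symm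
      congr 1
      ext i j
      simp only [Matrix.map_apply, ← CommRingCat.comp_apply, Scheme.Hom.appLE_map,
        Scheme.Hom.map_appLE]
    rw [mem_range_iff hσρφ] at k2
    rw [res_mulVec, res_mulVec]
    exact k2
  · rintro _ ⟨v, rfl⟩
    refine mulVec_mem (fun k => ?_) v
    have := F.pull_mem_pullback f (V := V) (h.trans e) (hA.col_mem k)
    convert this using 1
    funext j
    simp only [Matrix.map_apply, pull, ← CommRingCat.comp_apply, Scheme.Hom.appLE_map]

/-- Locally the locus is the nonvanishing locus of a minor, and minors commute with ring
homomorphisms. -/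
lemma Subsheaf.locus_pullback {T S : Scheme.{u}} {n r : ℕ} (f : T ⟶ S) {F : Subsheaf S n}
    (hF : IsLocallySummand r F) (σ : Fin r ↪ Fin n) :
    (F.pullback f).locus σ = f ⁻¹ᵁ F.locus σ := by
  ext p
  obtain ⟨W, A, C, hp, hCA, hA⟩ := hF (f p)
  replace hA : F.IsRange W A := hA
  have h1 := (hA.pullback hCA f (f ⁻¹ᵁ W) le_rfl).mem_locus_iff σ (p := p) hp
  have h2 := hA.mem_locus_iff σ hp
  change p ∈ (F.pullback f).locus σ ↔ f p ∈ F.locus σ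
  rw [h1, h2, Matrix.submatrix_map, ← RingHom.mapMatrix_apply, ← RingHom.map_det,
    Scheme.basicOpen_appLE]
  exact ⟨fun h => h.2, fun h => ⟨hp, h⟩⟩

/-- Multilinearity in the rows expands 1 = det (C A) as a combination of the determinants of A with
rows f(1), …, f(r), over all functions f. Those with f not injective vanish because of a repeated
row. If all the others were nonunits at p, then 1 would lie in the maximal ideal of the stalk. -/
lemma exists_det_submatrix_mem_basicOpen {S : Scheme.{u}} {n r : ℕ} {W : S.Opens}
    {A : Matrix (Fin n) (Fin r) Γ(S, W)} {C : Matrix (Fin r) (Fin n) Γ(S, W)} (hCA : C * A = 1)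
    {p : S} (hp : p ∈ W) :
    ∃ σ : Fin r ↪ Fin n, p ∈ S.basicOpen (A.submatrix σ id).det := by
  classical
  by_contra! hno
  have hexp : (C * A).det =
      ∑ f : Fin r → Fin n, (∏ k, C k (f k)) * (A.submatrix f id).det := by
    have hrow : C * A = fun k => ∑ j, C k j • A j := by
      ext k l
      simp [Matrix.mul_apply]
    have := (Matrix.detRowAlternating (R := Γ(S, W)) (n := Fin r)).toMultilinearMap.map_sum
      (fun k j => C k j • A j)
    rw [hrow]
    refine this.trans (Finset.sum_congr rfl fun f _ => ?_)
    exact (Matrix.detRowAlternating (R := Γ(S, W)) (n := Fin r)).toMultilinearMap.map_smul_univ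
      (fun k => C k (f k)) (fun k => A (f k))
  rw [hCA, Matrix.det_one] at hexp
  have h1 := congrArg (S.presheaf.germ W p hp) hexp
  rw [map_one, map_sum] at h1
  have hmem : (1 : S.presheaf.stalk p) ∈ IsLocalRing.maximalIdeal (S.presheaf.stalk p) := by
    rw [h1]
    refine Ideal.sum_mem _ fun f _ => ?_
    rw [map_mul]
    refine Ideal.mul_mem_left _ _ ?_
    by_cases hf : Function.Injective f
    · have := hno ⟨f, hf⟩
      rw [S.mem_basicOpen _ _ hp] at this
      exact this
    · simp only [Function.Injective, not_forall] at hf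
      obtain ⟨a, b, hab, hne⟩ := hf
      rw [Matrix.det_zero_of_row_eq hne (by ext l; simp [hab]), map_zero]
      exact Ideal.zero_mem _
  exact (IsLocalRing.maximalIdeal.isMaximal _).ne_top ((Ideal.eq_top_iff_one _).2 hmem)

lemma IsLocallySummand.exists_mem_locus {S : Scheme.{u}} {n r : ℕ} {F : Subsheaf S n}
    (hF : IsLocallySummand r F) (p : S) : ∃ σ : Fin r ↪ Fin n, p ∈ F.locus σ := by
  obtain ⟨W, A, C, hp, hCA, hA⟩ := hF p
  obtain ⟨σ, hσ⟩ := exists_det_submatrix_mem_basicOpen hCA hp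
  exact ⟨σ, (Subsheaf.IsRange.mem_locus_iff (F := F) hA σ hp).2 hσ⟩

/-- On this locus the σ-minor of a local spanning matrix is invertible, so the coordinates at σ
determine a section. Uniqueness of frames and the fact that they span both follow. -/
lemma IsLocallySummand.eq_zero_of_mem {S : Scheme.{u}} {n r : ℕ} {F : Subsheaf S n}
    (hF : IsLocallySummand r F) {σ : Fin r ↪ Fin n} {V : S.Opens} (hV : V ≤ F.locus σ)
    {s : Fin n → Γ(S, V)} (hs : s ∈ F.sections V) (hσ : ∀ k, s (σ k) = 0) : s = 0 := by
  refine eq_of_local fun p hp => ?_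
  obtain ⟨W, A, C, hpW, hCA, hA⟩ := hF p
  obtain ⟨V₁, P, hpV₁, hP⟩ := hV hp
  have hle : V₁ ⊓ (W ⊓ V) ≤ W := inf_le_right.trans inf_le_left
  have hle' : V₁ ⊓ (W ⊓ V) ≤ V := inf_le_right.trans inf_le_right
  refine ⟨V₁ ⊓ (W ⊓ V), hle', ⟨hpV₁, hpW, hp⟩, ?_⟩
  have hu := (Subsheaf.IsRange.exists_isFrame_iff (F := F) hA σ _ hle).1 ⟨_, hP.res inf_le_left⟩
  rw [RingHom.map_det, RingHom.mapMatrix_apply, ← Matrix.submatrix_map] at hu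
  have hs' := F.res_mem hle' hs
  rw [hA _ hle] at hs'
  obtain ⟨v, hv⟩ := hs'
  rw [Matrix.mulVecLin_apply] at hv
  have hv0 : ((A.map (resHom hle)).submatrix σ id).mulVec v = 0 := by
    funext k
    refine (congrFun hv (σ k)).trans ?_
    simp [res, hσ]
  have : v = 0 := by
    have h3 := congrArg (((A.map (resHom hle)).submatrix σ id)⁻¹).mulVec hv0
    rwa [Matrix.mulVec_mulVec, Matrix.nonsing_inv_mul _ hu, Matrix.one_mulVec,
      Matrix.mulVec_zero] at h3
  rw [← hv, this, Matrix.mulVec_zero]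
  funext j
  simp [res]

lemma Subsheaf.IsFrame.unique {S : Scheme.{u}} {n r : ℕ} {F : Subsheaf S n}
    (hF : IsLocallySummand r F) {σ : Fin r ↪ Fin n} {V : S.Opens}
    {P Q : Matrix (Fin n) (Fin r) Γ(S, V)} (hP : F.IsFrame σ V P) (hQ : F.IsFrame σ V Q) :
    P = Q := by
  ext j k
  have hV : V ≤ F.locus σ := fun p hp => ⟨V, P, hp, hP⟩
  have := hF.eq_zero_of_mem hV (Submodule.sub_mem _ (hP.1 k) (hQ.1 k)) fun l => by
    have h1 := congrFun (congrFun hP.2 l) k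
    have h2 := congrFun (congrFun hQ.2 l) k
    simp only [Matrix.submatrix_apply, id] at h1 h2
    simp [h1, h2]
  exact sub_eq_zero.1 (congrFun this j)

lemma Subsheaf.IsFrame.isRange {S : Scheme.{u}} {n r : ℕ} {F : Subsheaf S n}
    (hF : IsLocallySummand r F) {σ : Fin r ↪ Fin n} {W : S.Opens}
    {P : Matrix (Fin n) (Fin r) Γ(S, W)} (hP : F.IsFrame σ W P) : F.IsRange W P := by
  intro V h
  have hPV := hP.res h
  apply le_antisymm
  · intro s hs
    refine ⟨s ∘ σ, ?_⟩
    have hV : V ≤ F.locus σ := fun p hp => ⟨V, _, hp, hPV⟩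
    rw [Matrix.mulVecLin_apply]
    refine sub_eq_zero.1 (hF.eq_zero_of_mem hV
      (Submodule.sub_mem _ (mulVec_mem hPV.1 _) hs) fun k => ?_)
    have : ((P.map (resHom h)).submatrix σ id).mulVec (s ∘ σ) = s ∘ σ := by
      rw [hPV.2, Matrix.one_mulVec]
    exact sub_eq_zero.2 (congrFun this k)
  · rintro _ ⟨v, rfl⟩
    exact mulVec_mem hPV.1 v

/-- Normalised frames are unique, so local ones agree on overlaps and their entries glue. -/
lemma IsLocallySummand.exists_isFrame {S : Scheme.{u}} {n r : ℕ} {F : Subsheaf S n}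
    (hF : IsLocallySummand r F) {σ : Fin r ↪ Fin n} {V : S.Opens} (hV : V ≤ F.locus σ) :
    ∃ P, F.IsFrame σ V P := by
  have hloc : ∀ p : V, ∃ (W : S.Opens) (P : Matrix (Fin n) (Fin r) Γ(S, W)),
      (p : S) ∈ W ∧ W ≤ V ∧ F.IsFrame σ W P := fun p => by
    obtain ⟨W, P, hp, hP⟩ := hV p.2
    exact ⟨W ⊓ V, _, ⟨hp, p.2⟩, inf_le_right, hP.res inf_le_left⟩
  choose W P hp hWV hP using hloc
  have hglue : ∀ j k, ∃ a : Γ(S, V), ∀ p, resHom (hWV p) a = P p j k := by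
    intro j k
    obtain ⟨a, ha, -⟩ := S.sheaf.existsUnique_gluing' W V (fun p => homOfLE (hWV p))
      (fun p hp' => TopologicalSpace.Opens.mem_iSup.2 ⟨⟨p, hp'⟩, hp _⟩)
      (fun p => P p j k) (fun p q => by
        have := ((hP p).res (inf_le_left : W p ⊓ W q ≤ W p)).unique hF
          ((hP q).res (inf_le_right : W p ⊓ W q ≤ W q))
        exact congrFun (congrFun this j) k)
    exact ⟨a, ha⟩
  choose Q hQ using hglue
  have hres : ∀ p, (Matrix.of Q).map (resHom (hWV p)) = P p := fun p => by
    ext j k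
    exact hQ j k p
  refine ⟨Matrix.of Q, fun k => F.mem_of_local fun p hp' =>
    ⟨W ⟨p, hp'⟩, hWV _, hp _, ?_⟩, ?_⟩
  · have := (hP ⟨p, hp'⟩).1 k
    rw [← hres] at this
    exact this
  · ext l k
    have := eq_of_local (s := fun k : Fin r => Q (σ l) k)
      (t := fun k => (1 : Matrix (Fin r) (Fin r) Γ(S, V)) l k) fun p hp' =>
        ⟨W ⟨p, hp'⟩, hWV _, hp _, by
          funext k
          have h1 := congrFun (congrFun (hP ⟨p, hp'⟩).2 l) k
          rw [← hres] at h1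
          refine h1.trans ?_
          simp only [res]
          rw [Matrix.one_apply, Matrix.one_apply]
          split_ifs <;> simp⟩
    exact congrFun this k

/-! ### Gluing subsheaves -/

lemma pull_congr {T S : Scheme.{u}} {n : ℕ} {f g : T ⟶ S} (h : f = g) {W : S.Opens}
    {V : T.Opens} (e : V ≤ f ⁻¹ᵁ W) (s : Fin n → Γ(S, W)) :
    pull f W V e s = pull g W V (h ▸ e) s := by
  subst h
  rfl

/-- Pulling back along an open immersion loses no information: the inverse of `appIso` turns
pullbacks of sections into restrictions to the image, hence generators of the pullback into sections
of F. -/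
lemma res_mem_of_pull_mem_pullback {U S : Scheme.{u}} {n : ℕ} (f : U ⟶ S) [IsOpenImmersion f]
    (F : Subsheaf S n) {W : S.Opens} {V : U.Opens} (e : V ≤ f ⁻¹ᵁ W) (e' : f ''ᵁ V ≤ W)
    {s : Fin n → Γ(S, W)} (hs : pull f W V e s ∈ (F.pullback f).sections V) :
    res e' s ∈ F.sections (f ''ᵁ V) := by
  refine F.mem_of_local ?_
  rintro _ ⟨q, hq, rfl⟩
  obtain ⟨W₀, V', h, e₀, hq', hs'⟩ := hs q hq
  have key : ∀ {W₁ : S.Opens} (e₁ : V' ≤ f ⁻¹ᵁ W₁) (h₁ : f ''ᵁ V' ≤ W₁)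
      (t : Fin n → Γ(S, W₁)),
      (fun j => (f.appIso V').inv.hom (pull f W₁ V' e₁ t j)) = res h₁ t := by
    intro W₁ e₁ h₁ t
    funext j
    simp only [pull, res, ← CommRingCat.comp_apply, Scheme.Hom.appLE_appIso_inv]
  refine ⟨f ''ᵁ V', f.image_mono h, ⟨q, hq', rfl⟩, ?_⟩
  rw [res_res]
  rw [res_pull] at hs'
  have h₀ : f ''ᵁ V' ≤ W₀ := by
    rintro _ ⟨x, hx, rfl⟩
    exact e₀ hx
  have := map_mem_span (f.appIso V').inv.hom (Y := (F.sections (f ''ᵁ V') : Set _)) ?_ hs'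
  · rw [key _ ((f.image_mono h).trans e')] at this
    rwa [Submodule.span_eq] at this
  · rintro _ ⟨t, ht, rfl⟩
    rw [key _ h₀]
    exact F.res_mem h₀ ht

lemma exists_pull_eq {U S : Scheme.{u}} {n : ℕ} (f : U ⟶ S) [IsOpenImmersion f] (V : U.Opens)
    (t : Fin n → Γ(U, V)) : ∃ s : Fin n → Γ(S, f ''ᵁ V),
      pull f (f ''ᵁ V) V (f.preimage_image_eq V).ge s = t := by
  refine ⟨fun j => (f.appIso V).inv.hom (t j), ?_⟩
  funext j
  simp only [pull, ← CommRingCat.comp_apply, ← Scheme.Hom.appIso_hom', Iso.inv_hom_id]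
  rfl

lemma Subsheaf.le_of_pullback_le {S : Scheme.{u}} {n : ℕ} (𝓤 : S.OpenCover) {F G : Subsheaf S n}
    (h : ∀ j V, (F.pullback (𝓤.f j)).sections V ≤ (G.pullback (𝓤.f j)).sections V) (V : S.Opens) :
    F.sections V ≤ G.sections V := by
  intro s hs
  refine G.mem_of_local fun p hp => ?_
  obtain ⟨q, hq⟩ := 𝓤.covers p
  have hle : 𝓤.f (𝓤.idx p) ''ᵁ (𝓤.f (𝓤.idx p) ⁻¹ᵁ V) ≤ V := Scheme.Hom.image_preimage_le _ _
  refine ⟨_, hle, ⟨q, ?_, hq⟩, res_mem_of_pull_mem_pullback _ G le_rfl hle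
    (h _ _ (F.pull_mem_pullback _ le_rfl hs))⟩
  change 𝓤.f (𝓤.idx p) q ∈ V
  rwa [hq]

lemma Subsheaf.eq_of_pullback_eq {S : Scheme.{u}} {n : ℕ} (𝓤 : S.OpenCover) {F G : Subsheaf S n}
    (h : ∀ j, F.pullback (𝓤.f j) = G.pullback (𝓤.f j)) : F = G := by
  ext V : 2
  exact le_antisymm (le_of_pullback_le 𝓤 (fun j V => by rw [h]) V)
    (le_of_pullback_le 𝓤 (fun j V => by rw [h]) V)

/-- The sections of `𝒪_S^n` which belong to the given subsheaves on all members of an open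
cover. -/
def Subsheaf.glue {S : Scheme.{u}} {n : ℕ} (𝓤 : S.OpenCover) (F : ∀ j, Subsheaf (𝓤.X j) n) :
    Subsheaf S n where
  sections V :=
    { carrier := {s | ∀ j, pull (𝓤.f j) V (𝓤.f j ⁻¹ᵁ V) le_rfl s ∈ (F j).sections _}
      zero_mem' := fun j => by
        convert Submodule.zero_mem ((F j).sections (𝓤.f j ⁻¹ᵁ V))
        funext k
        simp [pull]
      add_mem' := fun {s t} hs ht j => by
        convert Submodule.add_mem _ (hs j) (ht j)
        funext k
        simp [pull]
      smul_mem' := fun a s hs j => by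
        convert Submodule.smul_mem _ (((𝓤.f j).appLE V _ le_rfl).hom a) (hs j)
        funext k
        simp [pull] }
  res_mem := by
    intro V W h s hs j
    have := (F j).res_mem (W := 𝓤.f j ⁻¹ᵁ W) ((𝓤.f j).preimage_mono h) (hs j)
    rw [res_pull] at this
    rwa [pull_res]
  mem_of_local := by
    intro V s hs j
    refine (F j).mem_of_local fun q hq => ?_
    obtain ⟨W, h, hp, hW⟩ := hs (𝓤.f j q) hq
    refine ⟨𝓤.f j ⁻¹ᵁ W, (𝓤.f j).preimage_mono h, hp, ?_⟩
    have := hW j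
    rw [pull_res] at this
    rwa [res_pull]

/-- Compatibility on the fibre products is what makes every section of F k come from a section of
the glued sheaf: it allows membership on the other members of the cover to be checked. -/
lemma Subsheaf.pullback_glue {S : Scheme.{u}} {n : ℕ} (𝓤 : S.OpenCover)
    (F : ∀ j, Subsheaf (𝓤.X j) n)
    (hF : ∀ i j, (F i).pullback (Limits.pullback.fst (𝓤.f i) (𝓤.f j)) =
      (F j).pullback (Limits.pullback.snd (𝓤.f i) (𝓤.f j))) (k : 𝓤.I₀) :
    (Subsheaf.glue 𝓤 F).pullback (𝓤.f k) = F k := by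
  ext V t
  constructor
  · intro ht
    refine (F k).mem_of_local fun q hq => ?_
    obtain ⟨W, V', h, e, hq', ht'⟩ := ht q hq
    refine ⟨V', h, hq', Submodule.span_le.2 ?_ ht'⟩
    rintro _ ⟨s, hs, rfl⟩
    have := (F k).res_mem e (hs k)
    rwa [res_pull] at this
  · intro ht
    obtain ⟨s, rfl⟩ := exists_pull_eq (𝓤.f k) V t
    refine Subsheaf.pull_mem_pullback _ _ _ fun j => ?_
    refine (F j).mem_of_local ?_
    rintro q ⟨q', hq', hqq'⟩
    -- The point z of the fibre product lies over both q and q'; near it, `hF` compares F j with F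
    -- k.
    obtain ⟨z, hz₁, hz₂⟩ := Scheme.Pullback.exists_preimage_pullback q q' hqq'.symm
    let a := Limits.pullback.fst (𝓤.f j) (𝓤.f k)
    let b := Limits.pullback.snd (𝓤.f j) (𝓤.f k)
    have hab : a ≫ 𝓤.f j = b ≫ 𝓤.f k := Limits.pullback.condition
    have hV : b ⁻¹ᵁ V ≤ a ⁻¹ᵁ (𝓤.f j ⁻¹ᵁ (𝓤.f k ''ᵁ V)) := by
      intro x hx
      refine ⟨b x, hx, ?_⟩
      have := congrArg (fun g : _ ⟶ S => g x) hab
      simpa using this.symm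
    have hle : a ''ᵁ (b ⁻¹ᵁ V) ≤ 𝓤.f j ⁻¹ᵁ (𝓤.f k ''ᵁ V) := by
      rintro _ ⟨x, hx, rfl⟩
      exact hV hx
    refine ⟨_, hle, ⟨z, ?_, hz₁⟩, res_mem_of_pull_mem_pullback a (F j) hV hle ?_⟩
    · change b z ∈ V
      rw [show b z = q' from hz₂]
      exact hq'
    · rw [hF j k, pull_pull]
      have := (F k).pull_mem_pullback b (V := b ⁻¹ᵁ V) le_rfl ht
      rw [pull_pull] at this
      exact (pull_congr hab _ s).symm ▸ this

/-- The matrices A and C are transported to the image of W by the inverse of `appIso`. Membership in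
F and the equation A (C s) = s can both be tested after pulling back. -/
lemma isLocallySummand_of_openCover {S : Scheme.{u}} {n r : ℕ} (𝓤 : S.OpenCover)
    {F : Subsheaf S n} (h : ∀ j, IsLocallySummand r (F.pullback (𝓤.f j))) :
    IsLocallySummand r F := by
  intro p
  obtain ⟨q, hq⟩ := 𝓤.covers p
  set f := 𝓤.f (𝓤.idx p)
  obtain ⟨W, A, C, hqW, hCA, hA⟩ := h _ q
  replace hA : (F.pullback f).IsRange W A := hA
  let φ := (f.appIso W).inv.hom
  have hφCA := map_mul_eq_one φ hCA
  refine ⟨f ''ᵁ W, A.map φ, C.map φ, ⟨q, hqW, hq⟩, hφCA, fun V hV => ?_⟩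
  have hVf : f ''ᵁ (f ⁻¹ᵁ V) = V := by
    rw [Scheme.Hom.image_preimage_eq_opensRange_inf]
    exact inf_eq_right.2 (hV.trans (f.image_le_opensRange W))
  have hW' : f ⁻¹ᵁ V ≤ W := by
    intro x hx
    obtain ⟨y, hy, hxy⟩ := hV hx
    rwa [← f.isOpenEmbedding.injective hxy]
  have hmem : ∀ s : Fin n → Γ(S, V), s ∈ F.sections V ↔
      pull f V (f ⁻¹ᵁ V) le_rfl s ∈ (F.pullback f).sections (f ⁻¹ᵁ V) := by
    intro s
    refine ⟨fun hs => F.pull_mem_pullback f le_rfl hs, fun hs => ?_⟩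
    have := res_mem_of_pull_mem_pullback f F le_rfl hVf.le hs
    have h2 := F.res_mem hVf.ge this
    rwa [res_res, res_self] at h2
  have hinj : ∀ s t : Fin n → Γ(S, V),
      pull f V (f ⁻¹ᵁ V) le_rfl s = pull f V (f ⁻¹ᵁ V) le_rfl t → s = t := by
    intro s t hst
    have : IsIso (f.app V) := f.isIso_app V (hV.trans (f.image_le_opensRange W))
    funext j
    have h1 := congrFun hst j
    simp only [pull, Scheme.Hom.appLE_eq_app] at h1
    exact (ConcreteCategory.bijective_of_isIso (f.app V)).1 h1
  have hmul : ∀ {m l : ℕ} (B : Matrix (Fin m) (Fin l) Γ(𝓤.X (𝓤.idx p), W)),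
      ((B.map φ).map (resHom hV)).map (f.appLE V (f ⁻¹ᵁ V) le_rfl).hom = B.map (resHom hW') := by
    intro m l B
    ext i j
    simp only [Matrix.map_apply, φ, ← CommRingCat.comp_apply, Category.assoc,
      Scheme.Hom.map_appLE, Scheme.Hom.appIso_inv_appLE]
  ext s
  rw [hmem, hA _ hW', mem_range_iff (map_mul_eq_one (resHom hW') hCA),
    mem_range_iff (map_mul_eq_one (resHom hV) hφCA)]
  have e1 := map_mulVec' (f.appLE V (f ⁻¹ᵁ V) le_rfl).hom ((A.map φ).map (resHom hV))
    (((C.map φ).map (resHom hV)).mulVec s)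
  have e2 := map_mulVec' (f.appLE V (f ⁻¹ᵁ V) le_rfl).hom ((C.map φ).map (resHom hV)) s
  rw [e2, hmul, hmul] at e1
  constructor
  · intro hs
    exact hinj _ _ (e1.trans hs)
  · intro hs
    exact e1.symm.trans (congrArg (pull f V (f ⁻¹ᵁ V) le_rfl) hs)

/-! ### Subsheaves given by matrices -/

/-- Selecting the rows of σ is a retraction of a normalised frame, so a normalised matrix always
spans a direct summand. -/
lemma selection_mul {A : Type u} [CommRing A] {n r : ℕ} {σ : Fin r ↪ Fin n}
    {P : Matrix (Fin n) (Fin r) A} (hP : P.submatrix σ id = 1) :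
    (1 : Matrix (Fin n) (Fin n) A).submatrix σ id * P = 1 := by
  rw [← hP]
  ext l k
  simp [Matrix.mul_apply, Matrix.one_apply]

lemma mem_range_of_submatrix_eq_one {A : Type u} [CommRing A] {n r : ℕ} {σ : Fin r ↪ Fin n}
    {P : Matrix (Fin n) (Fin r) A} (hP : P.submatrix σ id = 1) (s : Fin n → A) :
    s ∈ LinearMap.range P.mulVecLin ↔ P.mulVec (s ∘ σ) = s := by
  rw [mem_range_iff (selection_mul hP)]
  have : ((1 : Matrix (Fin n) (Fin n) A).submatrix σ id).mulVec s = s ∘ σ := by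
    funext k
    simp [Matrix.mulVec, dotProduct, Matrix.one_apply]
  rw [this]

lemma map_submatrix_eq_one {A B : Type u} [CommRing A] [CommRing B] {n r : ℕ} (φ : A →+* B)
    {σ : Fin r ↪ Fin n} {P : Matrix (Fin n) (Fin r) A} (hP : P.submatrix σ id = 1) :
    (P.map φ).submatrix σ id = 1 := by
  rw [Matrix.submatrix_map, hP, Matrix.map_one _ (map_zero _) (map_one _)]

/-- The column space of a matrix of global functions. -/
def Subsheaf.ofMatrix {S : Scheme.{u}} {n r : ℕ} {σ : Fin r ↪ Fin n}
    (P : Matrix (Fin n) (Fin r) Γ(S, ⊤)) (hP : P.submatrix σ id = 1) : Subsheaf S n where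
  sections V := LinearMap.range (P.map (resHom (le_top : V ≤ ⊤))).mulVecLin
  res_mem := by
    rintro V W h _ ⟨v, rfl⟩
    rw [Matrix.mulVecLin_apply, res_mulVec, map_resHom_resHom]
    exact ⟨_, rfl⟩
  mem_of_local := by
    intro V s hs
    rw [mem_range_of_submatrix_eq_one (map_submatrix_eq_one _ hP)]
    refine eq_of_local fun p hp => ?_
    obtain ⟨W, h, hp, hW⟩ := hs p hp
    rw [mem_range_of_submatrix_eq_one (map_submatrix_eq_one _ hP)] at hW
    refine ⟨W, h, hp, ?_⟩
    rw [res_mulVec, map_resHom_resHom]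
    exact hW

lemma Subsheaf.isRange_ofMatrix {S : Scheme.{u}} {n r : ℕ} {σ : Fin r ↪ Fin n}
    (P : Matrix (Fin n) (Fin r) Γ(S, ⊤)) (hP : P.submatrix σ id = 1) :
    (ofMatrix P hP).IsRange ⊤ P := fun _ _ => rfl

lemma Subsheaf.isLocallySummand_ofMatrix {S : Scheme.{u}} {n r : ℕ} {σ : Fin r ↪ Fin n}
    (P : Matrix (Fin n) (Fin r) Γ(S, ⊤)) (hP : P.submatrix σ id = 1) :
    IsLocallySummand r (ofMatrix P hP) := fun _ =>
  ⟨⊤, P, _, trivial, selection_mul hP, isRange_ofMatrix P hP⟩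

lemma Subsheaf.isFrame_ofMatrix {S : Scheme.{u}} {n r : ℕ} {σ : Fin r ↪ Fin n}
    (P : Matrix (Fin n) (Fin r) Γ(S, ⊤)) (hP : P.submatrix σ id = 1) :
    (ofMatrix P hP).IsFrame σ ⊤ P :=
  ⟨(isRange_ofMatrix P hP).col_mem, hP⟩

lemma Subsheaf.IsRange.eq {S : Scheme.{u}} {n r : ℕ} {F G : Subsheaf S n}
    {P : Matrix (Fin n) (Fin r) Γ(S, ⊤)} (hF : F.IsRange ⊤ P) (hG : G.IsRange ⊤ P) : F = G := by
  ext V : 2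
  rw [hF V le_top, hG V le_top]

lemma Subsheaf.IsFrame.eq {S : Scheme.{u}} {n r : ℕ} {F G : Subsheaf S n}
    {σ : Fin r ↪ Fin n} {P : Matrix (Fin n) (Fin r) Γ(S, ⊤)} (hF : IsLocallySummand r F)
    (hG : IsLocallySummand r G) (hFP : F.IsFrame σ ⊤ P) (hGP : G.IsFrame σ ⊤ P) : F = G :=
  (hFP.isRange hF).eq (hGP.isRange hG)

/-! ### Framed chains -/

/-- The equations on the frames of a chain which express that the transition maps respect it. -/
def IsChart {O : Type u} [CommRing O] (ϖ : O) {n r : ℕ} {A : Type u} [CommRing A] (φ : O →+* A)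
    (σ : Fin n → Fin r ↪ Fin n) (P : Fin n → Matrix (Fin n) (Fin r) A) : Prop :=
  (∀ i, (P i).submatrix (σ i) id = 1) ∧
    ∀ i j k, φ (transition ϖ i j) * P i j k =
      ∑ l, P (finRotate n i) j l *
        (φ (transition ϖ i (σ (finRotate n i) l)) * P i (σ (finRotate n i) l) k)

/-- The chain `c` is framed by the matrices `P`, normalised along `σ`. -/
def Chain.IsFramed {O : Type u} [CommRing O] {ϖ : O} {n r : ℕ} {S : Over (Spec (.of O))}
    (c : Chain ϖ n r S) (σ : Fin n → Fin r ↪ Fin n)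
    (P : Fin n → Matrix (Fin n) (Fin r) Γ(S.left, ⊤)) : Prop :=
  ∀ i, (c.F i).IsFrame (σ i) ⊤ (P i)

/-- The open subset over which `c` can be framed along `σ`. -/
def Chain.locus {O : Type u} [CommRing O] {ϖ : O} {n r : ℕ} {S : Over (Spec (.of O))}
    (c : Chain ϖ n r S) (σ : Fin n → Fin r ↪ Fin n) : S.left.Opens where
  carrier := {p | ∀ i, p ∈ (c.F i).locus (σ i)}
  is_open' := by
    simp only [Set.ofPred_forall]
    exact isOpen_iInter_of_finite fun i => ((c.F i).locus (σ i)).isOpen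

section

variable {O : Type u} [CommRing O] {ϖ : O} {n r : ℕ} {S T : Over (Spec (.of O))}
  {σ : Fin n → Fin r ↪ Fin n}

lemma Chain.mem_locus {c : Chain ϖ n r S} {p : S.left} :
    p ∈ c.locus σ ↔ ∀ i, p ∈ (c.F i).locus (σ i) := Iff.rfl

lemma Chain.locus_pullback (f : T ⟶ S) (c : Chain ϖ n r S) :
    (c.pullback f).locus σ = f.left ⁻¹ᵁ c.locus σ := by
  ext p
  change p ∈ (c.pullback f).locus σ ↔ f.left p ∈ c.locus σ
  rw [mem_locus, mem_locus]
  refine forall_congr' fun i => ?_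
  change p ∈ ((c.F i).pullback f.left).locus (σ i) ↔ _
  rw [Subsheaf.locus_pullback f.left (c.isLocallySummand i)]
  rfl

lemma Chain.exists_mem_locus (c : Chain ϖ n r S) (p : S.left) :
    ∃ σ : Fin n → Fin r ↪ Fin n, p ∈ c.locus σ := by
  choose σ hσ using fun i => (c.isLocallySummand i).exists_mem_locus p
  exact ⟨σ, mem_locus.2 hσ⟩

lemma Chain.exists_isFramed {c : Chain ϖ n r S} (hc : c.locus σ = ⊤) :
    ∃ P, c.IsFramed σ P := by
  have : ∀ i, ∃ P, (c.F i).IsFrame (σ i) ⊤ P := fun i =>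
    (c.isLocallySummand i).exists_isFrame fun p _ => mem_locus.1 (hc.ge (show p ∈ ⊤ from trivial)) i
  choose P hP using this
  exact ⟨P, hP⟩

lemma Chain.IsFramed.locus_eq_top {c : Chain ϖ n r S}
    {P : Fin n → Matrix (Fin n) (Fin r) Γ(S.left, ⊤)} (hP : c.IsFramed σ P) :
    c.locus σ = ⊤ := by
  rw [eq_top_iff]
  intro p _
  exact mem_locus.2 fun i => ⟨⊤, P i, trivial, hP i⟩

lemma Chain.IsFramed.unique {c : Chain ϖ n r S}
    {P Q : Fin n → Matrix (Fin n) (Fin r) Γ(S.left, ⊤)} (hP : c.IsFramed σ P)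
    (hQ : c.IsFramed σ Q) : P = Q :=
  funext fun i => (hP i).unique (c.isLocallySummand i) (hQ i)

lemma Chain.IsFramed.eq {c d : Chain ϖ n r S}
    {P : Fin n → Matrix (Fin n) (Fin r) Γ(S.left, ⊤)} (hc : c.IsFramed σ P)
    (hd : d.IsFramed σ P) : c = d :=
  Chain.ext (funext fun i => (hc i).eq (c.isLocallySummand i) (d.isLocallySummand i) (hd i))

lemma Chain.IsFramed.pullback {c : Chain ϖ n r S}
    {P : Fin n → Matrix (Fin n) (Fin r) Γ(S.left, ⊤)} (hP : c.IsFramed σ P) (f : T ⟶ S) :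
    (c.pullback f).IsFramed σ
      fun i => (P i).map (f.left.appLE ⊤ ⊤ (le_preimage_top _ _)).hom :=
  fun i => (hP i).pullback f.left ⊤ (le_preimage_top _ _)

/-- The coefficients of the image of a column in the next frame can only be its coordinates at the
next selection. Preservation of the chain thus becomes a polynomial identity. -/
lemma Chain.IsFramed.isChart {c : Chain ϖ n r S}
    {P : Fin n → Matrix (Fin n) (Fin r) Γ(S.left, ⊤)} (hP : c.IsFramed σ P) :
    IsChart ϖ (scalar S ⊤) σ P := by
  refine ⟨fun i => (hP i).2, fun i j k => ?_⟩
  have h := c.map_mem i ⊤ _ ((hP i).1 k)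
  rw [(hP (finRotate n i)).isRange (c.isLocallySummand _) ⊤ le_rfl, map_resHom_self,
    mem_range_of_submatrix_eq_one (hP (finRotate n i)).2] at h
  exact (congrFun h j).symm

lemma IsChart.exists_isFramed {P : Fin n → Matrix (Fin n) (Fin r) Γ(S.left, ⊤)}
    (hP : IsChart ϖ (scalar S ⊤) σ P) : ∃ c : Chain ϖ n r S, c.IsFramed σ P := by
  refine ⟨⟨fun i => Subsheaf.ofMatrix (P i) (hP.1 i),
    fun i => Subsheaf.isLocallySummand_ofMatrix (P i) (hP.1 i), ?_⟩,
    fun i => Subsheaf.isFrame_ofMatrix (P i) (hP.1 i)⟩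
  rintro i V _ ⟨v, rfl⟩
  let ρ := resHom (le_top : V ≤ ⊤)
  -- The coefficients are the coordinates, at the rows selected for the next index, of the image of
  -- P_i v.
  refine ⟨fun l => ∑ k, ρ (scalar S ⊤ (transition ϖ i (σ (finRotate n i) l)) *
    P i (σ (finRotate n i) l) k) * v k, ?_⟩
  funext j
  have key : ∀ k, scalar S V (transition ϖ i j) * ρ (P i j k) =
      ∑ l, ρ (P (finRotate n i) j l) * ρ (scalar S ⊤ (transition ϖ i (σ (finRotate n i) l)) *
        P i (σ (finRotate n i) l) k) := by
    intro k
    have h := congrArg ρ (hP.2 i j k)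
    rw [map_mul, res_scalar, map_sum] at h
    rw [h]
    exact Finset.sum_congr rfl fun l _ => map_mul _ _ _
  simp only [chainMap, Matrix.mulVecLin_apply, Matrix.mulVec, dotProduct, Matrix.map_apply]
  change ∑ l, ρ (P (finRotate n i) j l) * _ = scalar S V (transition ϖ i j) *
    ∑ k, ρ (P i j k) * v k
  simp_rw [Finset.mul_sum, ← mul_assoc, key, Finset.sum_mul]
  exact Finset.sum_comm

end

/-! ### Affine charts -/

section

variable {O : Type u} [CommRing O] {ϖ : O} {n r : ℕ}

lemma IsChart.map {A B : Type u} [CommRing A] [CommRing B] {φ : O →+* A}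
    {σ : Fin n → Fin r ↪ Fin n} {P : Fin n → Matrix (Fin n) (Fin r) A} (hP : IsChart ϖ φ σ P)
    (ψ : A →+* B) : IsChart ϖ (ψ.comp φ) σ fun i => (P i).map ψ := by
  refine ⟨fun i => map_submatrix_eq_one ψ (hP.1 i), fun i j k => ?_⟩
  have := congrArg ψ (hP.2 i j k)
  simp only [map_mul, map_sum] at this
  exact this

variable (ϖ) (σ : Fin n → Fin r ↪ Fin n)

/-- The equations defining the chart of the local model given by `σ`. -/
def chartIdeal : Ideal (MvPolynomial (Fin n × Fin n × Fin r) O) :=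
  Ideal.span
    ({f | ∃ i l k, f = MvPolynomial.X (i, σ i l, k) - if l = k then 1 else 0} ∪
     {f | ∃ i j k, f = MvPolynomial.C (transition ϖ i j) * MvPolynomial.X (i, j, k) -
        ∑ l, MvPolynomial.X (finRotate n i, j, l) *
          (MvPolynomial.C (transition ϖ i (σ (finRotate n i) l)) *
            MvPolynomial.X (i, σ (finRotate n i) l, k))})

/-- The coordinate ring of the chart of the local model given by `σ`. -/
abbrev ChartRing : Type u := MvPolynomial (Fin n × Fin n × Fin r) O ⧸ chartIdeal ϖ σ

/-- The universal frames. -/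
def chartMatrix (i : Fin n) : Matrix (Fin n) (Fin r) (ChartRing ϖ σ) :=
  Matrix.of fun j k => Ideal.Quotient.mk _ (MvPolynomial.X (i, j, k))

lemma isChart_chartMatrix :
    IsChart ϖ (algebraMap O (ChartRing ϖ σ)) σ (chartMatrix ϖ σ) := by
  constructor
  · intro i
    ext l k
    have h : Ideal.Quotient.mk (chartIdeal ϖ σ)
        (MvPolynomial.X (i, σ i l, k) - if l = k then 1 else 0) = 0 :=
      Ideal.Quotient.eq_zero_iff_mem.2 (Ideal.subset_span (Or.inl ⟨i, l, k, rfl⟩))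
    rw [map_sub, sub_eq_zero] at h
    refine h.trans ?_
    rw [Matrix.one_apply]
    split_ifs <;> simp
  · intro i j k
    have h : Ideal.Quotient.mk (chartIdeal ϖ σ) _ = 0 :=
      Ideal.Quotient.eq_zero_iff_mem.2 (Ideal.subset_span (Or.inr ⟨i, j, k, rfl⟩))
    rw [map_sub, sub_eq_zero, map_mul, map_sum] at h
    refine h.trans (Finset.sum_congr rfl fun l _ => ?_)
    rw [map_mul, map_mul]
    rfl

variable {ϖ σ}

lemma IsChart.exists_ringHom {A : Type u} [CommRing A] {φ : O →+* A}
    {P : Fin n → Matrix (Fin n) (Fin r) A} (hP : IsChart ϖ φ σ P) :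
    ∃ ψ : ChartRing ϖ σ →+* A, ψ.comp (algebraMap O _) = φ ∧
      ∀ i, (chartMatrix ϖ σ i).map ψ = P i := by
  refine ⟨Ideal.Quotient.lift (chartIdeal ϖ σ)
    (MvPolynomial.eval₂Hom φ fun x => P x.1 x.2.1 x.2.2) ?_, ?_, ?_⟩
  · intro a ha
    rw [← RingHom.mem_ker]
    refine (Ideal.span_le (I := RingHom.ker _)).2 ?_ ha
    rintro f (⟨i, l, k, rfl⟩ | ⟨i, j, k, rfl⟩)
    · have := congrFun (congrFun (hP.1 i) l) k
      rw [Matrix.one_apply, Matrix.submatrix_apply] at this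
      rw [SetLike.mem_coe, RingHom.mem_ker, map_sub, sub_eq_zero]
      simp only [MvPolynomial.coe_eval₂Hom, MvPolynomial.eval₂_X]
      refine this.trans ?_
      split_ifs <;> simp
    · rw [SetLike.mem_coe, RingHom.mem_ker, map_sub, sub_eq_zero]
      simpa using hP.2 i j k
  · ext a
    have : algebraMap O (ChartRing ϖ σ) a =
      Ideal.Quotient.mk (chartIdeal ϖ σ) (MvPolynomial.C a) := rfl
    rw [RingHom.comp_apply, this, Ideal.Quotient.lift_mk]
    simp
  · intro i
    ext j k
    simp [chartMatrix]

lemma ChartRing.ringHom_ext {A : Type u} [CommRing A] {φ ψ : ChartRing ϖ σ →+* A}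
    (h : φ.comp (algebraMap O _) = ψ.comp (algebraMap O _))
    (h' : ∀ i, (chartMatrix ϖ σ i).map φ = (chartMatrix ϖ σ i).map ψ) : φ = ψ := by
  refine Ideal.Quotient.ringHom_ext (MvPolynomial.ringHom_ext (fun a => ?_) fun x => ?_)
  · exact congrArg (fun f => f a) h
  · exact congrFun (congrFun (h' x.1) x.2.1) x.2.2

variable (ϖ σ)

/-- The chart of the local model given by `σ`. -/
def chartScheme : Over (Spec (.of O)) :=
  Over.mk (Spec.map (CommRingCat.ofHom (algebraMap O (ChartRing ϖ σ))))

/-- The universal frames, as matrices of functions on the chart. -/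
def chartFrame (i : Fin n) : Matrix (Fin n) (Fin r) Γ((chartScheme ϖ σ).left, ⊤) :=
  (chartMatrix ϖ σ i).map (Scheme.ΓSpecIso (.of (ChartRing ϖ σ))).inv.hom

lemma appLE_top_top {S T : Scheme.{u}} (f : S ⟶ T) (e : ⊤ ≤ f ⁻¹ᵁ ⊤) :
    f.appLE ⊤ ⊤ e = f.appTop := Scheme.Hom.appLE_eq_app f

lemma scalar_chartScheme : scalar (chartScheme ϖ σ) ⊤ =
    (Scheme.ΓSpecIso (.of (ChartRing ϖ σ))).inv.hom.comp (algebraMap O _) := by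
  have := Scheme.ΓSpecIso_inv_naturality (CommRingCat.ofHom (algebraMap O (ChartRing ϖ σ)))
  refine Eq.trans ?_ (congrArg CommRingCat.Hom.hom this.symm)
  rw [scalar, appLE_top_top]
  rfl

lemma isChart_chartFrame :
    IsChart ϖ (scalar (chartScheme ϖ σ) ⊤) σ (chartFrame ϖ σ) := by
  rw [scalar_chartScheme]
  exact (isChart_chartMatrix ϖ σ).map _

/-- The universal chain over the chart given by `σ`. -/
def chartChain : Chain ϖ n r (chartScheme ϖ σ) := (isChart_chartFrame ϖ σ).exists_isFramed.choose

lemma isFramed_chartChain : (chartChain ϖ σ).IsFramed σ (chartFrame ϖ σ) :=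
  (isChart_chartFrame ϖ σ).exists_isFramed.choose_spec

variable {ϖ σ} {T : Over (Spec (.of O))}

lemma IsChart.exists_hom {P : Fin n → Matrix (Fin n) (Fin r) Γ(T.left, ⊤)}
    (hP : IsChart ϖ (scalar T ⊤) σ P) : ∃ g : T ⟶ chartScheme ϖ σ,
      ∀ i, (chartFrame ϖ σ i).map (g.left.appLE ⊤ ⊤ (le_preimage_top _ _)).hom = P i := by
  obtain ⟨ψ, hψ, hψP⟩ := hP.exists_ringHom
  refine ⟨Over.homMk (T.left.toSpecΓ ≫ Spec.map (CommRingCat.ofHom ψ)) ?_, fun i => ?_⟩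
  · change (T.left.toSpecΓ ≫ Spec.map (CommRingCat.ofHom ψ)) ≫
      Spec.map (CommRingCat.ofHom (algebraMap O (ChartRing ϖ σ))) = T.hom
    rw [Category.assoc, ← Spec.map_comp, ← CommRingCat.ofHom_comp, hψ]
    rw [scalar, appLE_top_top, CommRingCat.ofHom_hom, Spec.map_comp, ← Category.assoc,
      ← Scheme.toSpecΓ_naturality, Category.assoc]
    simp
  · rw [← hψP i]
    ext j k
    simp only [chartFrame, Matrix.map_apply, appLE_top_top]
    have : (Scheme.ΓSpecIso (.of (ChartRing ϖ σ))).inv ≫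
        (T.left.toSpecΓ ≫ Spec.map (CommRingCat.ofHom ψ)).appTop = CommRingCat.ofHom ψ := by
      simp
    exact congrArg (fun φ => φ.hom (chartMatrix ϖ σ i j k)) this

lemma chartScheme_hom_ext {g h : T ⟶ chartScheme ϖ σ}
    (hgh : ∀ i, (chartFrame ϖ σ i).map (g.left.appLE ⊤ ⊤ (le_preimage_top _ _)).hom =
      (chartFrame ϖ σ i).map (h.left.appLE ⊤ ⊤ (le_preimage_top _ _)).hom) : g = h := by
  simp only [appLE_top_top] at hgh
  ext1
  have : IsAffine (chartScheme ϖ σ).left :=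
    inferInstanceAs (IsAffine (Spec (.of (ChartRing ϖ σ))))
  refine ext_of_isAffine ?_
  refine (cancel_epi (Scheme.ΓSpecIso (.of (ChartRing ϖ σ))).inv).1 ?_
  refine CommRingCat.hom_ext (ChartRing.ringHom_ext ?_ fun i => ?_)
  · ext a
    have e1 := appLE_scalar g ⊤ ⊤ (le_preimage_top _ _) a
    have e2 := appLE_scalar h ⊤ ⊤ (le_preimage_top _ _) a
    rw [scalar_chartScheme, appLE_top_top] at e1 e2
    exact e1.trans e2.symm
  · exact hgh i

/-- The frame of c is unique and solves the chart equations, so it is the same datum as a morphism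
to the spectrum of `ChartRing ϖ σ`. -/
lemma Chain.existsUnique_hom_chartScheme {c : Chain ϖ n r T} (hc : c.locus σ = ⊤) :
    ∃! g : T ⟶ chartScheme ϖ σ, (chartChain ϖ σ).pullback g = c := by
  obtain ⟨P, hP⟩ := exists_isFramed hc
  obtain ⟨g, hg⟩ := hP.isChart.exists_hom
  have key : ∀ h : T ⟶ chartScheme ϖ σ, (chartChain ϖ σ).pullback h = c → ∀ i,
      (chartFrame ϖ σ i).map (h.left.appLE ⊤ ⊤ (le_preimage_top _ _)).hom = P i := by
    rintro h rfl i
    exact congrFun (((isFramed_chartChain ϖ σ).pullback h).unique hP) i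
  refine ⟨g, ?_, fun h hh => chartScheme_hom_ext fun i => (key h hh i).trans (hg i).symm⟩
  refine Chain.IsFramed.eq (P := P) ?_ hP
  have := (isFramed_chartChain ϖ σ).pullback g
  rwa [funext hg] at this

lemma locus_pullback_chartChain (g : T ⟶ chartScheme ϖ σ) :
    ((chartChain ϖ σ).pullback g).locus σ = ⊤ :=
  ((isFramed_chartChain ϖ σ).pullback g).locus_eq_top

end

/-! ### The local model as a functor on schemes -/

/-- A structure morphism to `Spec O` together with a chain. -/
@[ext]
structure PointedChain {O : Type u} [CommRing O] (ϖ : O) (n r : ℕ) (S : Scheme.{u}) where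
  /-- The structure morphism. -/
  hom : S ⟶ Spec (.of O)
  /-- The submodules of the chain. -/
  F : Fin n → Subsheaf S n
  isLocallySummand : ∀ i, IsLocallySummand r (F i)
  map_mem : ∀ (i : Fin n) (V : S.Opens) (s : Fin n → Γ(S, V)),
    s ∈ (F i).sections V → chainMap ϖ (Over.mk hom) V i s ∈ (F (finRotate n i)).sections V

section

variable {O : Type u} [CommRing O] {ϖ : O} {n r : ℕ}

/-- The underlying chain. -/
def PointedChain.toChain {S : Scheme.{u}} (c : PointedChain ϖ n r S) :
    Chain ϖ n r (Over.mk c.hom) :=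
  ⟨c.F, c.isLocallySummand, c.map_mem⟩

/-- A chain over an `O`-scheme, as a pointed chain. -/
def Chain.toPointed {S : Over (Spec (.of O))} (c : Chain ϖ n r S) : PointedChain ϖ n r S.left :=
  ⟨S.hom, c.F, c.isLocallySummand, c.map_mem⟩

lemma Chain.toPointed_injective {S : Over (Spec (.of O))} :
    Function.Injective (toPointed : Chain ϖ n r S → _) := fun _ _ h =>
  Chain.ext (congrArg PointedChain.F h)

/-- Pullback of pointed chains. -/
def PointedChain.pullback {S T : Scheme.{u}} (f : T ⟶ S) (c : PointedChain ϖ n r S) :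
    PointedChain ϖ n r T :=
  (c.toChain.pullback (Over.homMk f : Over.mk (f ≫ c.hom) ⟶ Over.mk c.hom)).toPointed

lemma Chain.toPointed_pullback {S T : Over (Spec (.of O))} (f : T ⟶ S) (c : Chain ϖ n r S) :
    (c.pullback f).toPointed = c.toPointed.pullback f.left :=
  PointedChain.ext (Over.w f).symm rfl

variable (O ϖ n r) in
/-- The functor of pointed chains. -/
def pointedLocalModel : Scheme.{u}ᵒᵖ ⥤ Type u where
  obj S := PointedChain ϖ n r S.unop
  map f := ↾(PointedChain.pullback f.unop)
  map_id S := by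
    ext : 1
    refine DFunLike.ext _ _ fun c => ?_
    exact PointedChain.ext (Category.id_comp _) (funext fun i => (c.F i).pullback_id)
  map_comp f g := by
    ext : 1
    refine DFunLike.ext _ _ fun c => ?_
    exact PointedChain.ext (Category.assoc _ _ _)
      (funext fun i => (c.F i).pullback_comp g.unop f.unop)

lemma PointedChain.pullback_pullback {S T U : Scheme.{u}} (g : U ⟶ T) (f : T ⟶ S)
    (c : PointedChain ϖ n r S) : (c.pullback f).pullback g = c.pullback (g ≫ f) :=
  PointedChain.ext (Category.assoc _ _ _).symm
      (funext fun i => ((c.F i).pullback_comp g f).symm)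

lemma PointedChain.ext_of_openCover {S : Scheme.{u}} (𝓤 : S.OpenCover)
    {c d : PointedChain ϖ n r S} (h : ∀ j, c.pullback (𝓤.f j) = d.pullback (𝓤.f j)) : c = d := by
  refine PointedChain.ext (𝓤.hom_ext _ _ fun j => congrArg hom (h j)) (funext fun i => ?_)
  exact Subsheaf.eq_of_pullback_eq 𝓤 fun j => congrFun (congrArg F (h j)) i

lemma PointedChain.exists_glue {S : Scheme.{u}} (𝓤 : S.OpenCover)
    (c : ∀ j, PointedChain ϖ n r (𝓤.X j))
    (hc : ∀ i j, (c i).pullback (Limits.pullback.fst (𝓤.f i) (𝓤.f j)) =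
      (c j).pullback (Limits.pullback.snd (𝓤.f i) (𝓤.f j))) :
    ∃ d : PointedChain ϖ n r S, ∀ j, d.pullback (𝓤.f j) = c j := by
  let p : S ⟶ Spec (.of O) := 𝓤.glueMorphisms (fun j => (c j).hom)
    fun i j => congrArg hom (hc i j)
  have hp : ∀ j, 𝓤.f j ≫ p = (c j).hom := fun j => 𝓤.ι_glueMorphisms _ _ j
  have hF : ∀ i k, (Subsheaf.glue 𝓤 fun j => (c j).F i).pullback (𝓤.f k) = (c k).F i :=
    fun i k => Subsheaf.pullback_glue 𝓤 _
      (fun a b => congrFun (congrArg F (hc a b)) i) k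
  refine ⟨⟨p, fun i => Subsheaf.glue 𝓤 fun j => (c j).F i,
    fun i => isLocallySummand_of_openCover 𝓤 fun k => ?_, fun i V s hs j => ?_⟩,
    fun j => PointedChain.ext (hp j) (funext fun i => hF i j)⟩
  · rw [hF]
    exact (c k).isLocallySummand i
  · have := (c j).map_mem i _ _ (hs j)
    let f : Over.mk (c j).hom ⟶ Over.mk p := Over.homMk (𝓤.f j) (hp j)
    have key : pull (𝓤.f j) V (𝓤.f j ⁻¹ᵁ V) le_rfl (chainMap ϖ (Over.mk p) V i s) =
        chainMap ϖ (Over.mk (c j).hom) (𝓤.f j ⁻¹ᵁ V) i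
          (pull (𝓤.f j) V (𝓤.f j ⁻¹ᵁ V) le_rfl s) := by
      funext k
      simp only [pull, chainMap, map_mul]
      rw [← appLE_scalar f V (𝓤.f j ⁻¹ᵁ V) le_rfl]
      rfl
    rw [← key] at this
    exact this

/-- Being a local summand and being respected by the transition maps are local conditions, so
descent reduces to gluing structure morphisms and subsheaves. -/
lemma isSheaf_pointedLocalModel :
    Presheaf.IsSheaf Scheme.zariskiTopology.{u} (pointedLocalModel O ϖ n r) := by
  rw [isSheaf_iff_isSheaf_of_type]
  rw [Precoverage.isSheaf_toGrothendieck_iff_of_isStableUnderBaseChange]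
  rintro S R hR x hx
  obtain ⟨(𝓤 : Scheme.OpenCover S), rfl⟩ := Scheme.exists_cover_of_mem_pretopology hR
  obtain ⟨d, hd⟩ := PointedChain.exists_glue 𝓤 (fun j => x (𝓤.f j) (.mk j)) fun i j =>
    hx _ _ _ _ Limits.pullback.condition
  refine ⟨d, ?_, fun d' hd' => ?_⟩
  · rintro Z _ ⟨j⟩
    exact hd j
  · exact PointedChain.ext_of_openCover 𝓤 fun j => (hd' (𝓤.f j) (.mk j)).trans (hd j).symm

/-! ### Representability -/

variable (ϖ) in
/-- The inclusion of the chart given by `σ`. -/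
def chartMap (σ : Fin n → Fin r ↪ Fin n) :
    yoneda.obj (chartScheme ϖ σ).left ⟶ pointedLocalModel O ϖ n r :=
  yonedaEquiv.symm (chartChain ϖ σ).toPointed

lemma PointedChain.exists_hom_chartScheme {σ : Fin n → Fin r ↪ Fin n} {T : Scheme.{u}}
    {c : PointedChain ϖ n r T} (hc : c.toChain.locus σ = ⊤) :
    ∃ g : T ⟶ (chartScheme ϖ σ).left, (chartChain ϖ σ).toPointed.pullback g = c := by
  obtain ⟨g, hg, -⟩ := Chain.existsUnique_hom_chartScheme hc
  refine ⟨g.left, ?_⟩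
  rw [← Chain.toPointed_pullback, hg]
  rfl

lemma hom_chartScheme_ext {σ : Fin n → Fin r ↪ Fin n} {T : Scheme.{u}}
    {g h : T ⟶ (chartScheme ϖ σ).left}
    (hgh : (chartChain ϖ σ).toPointed.pullback g = (chartChain ϖ σ).toPointed.pullback h) :
    g = h := by
  have hw : g ≫ (chartScheme ϖ σ).hom = h ≫ (chartScheme ϖ σ).hom :=
    congrArg PointedChain.hom hgh
  -- Since g and h induce the same structure morphism, both become O-morphisms from one source, and
  -- uniqueness over O applies.
  let g' : Over.mk (g ≫ (chartScheme ϖ σ).hom) ⟶ chartScheme ϖ σ := Over.homMk g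
  let h' : Over.mk (g ≫ (chartScheme ϖ σ).hom) ⟶ chartScheme ϖ σ := Over.homMk h hw.symm
  have : (chartChain ϖ σ).pullback g' = (chartChain ϖ σ).pullback h' :=
    Chain.ext (congrArg PointedChain.F hgh)
  have key := (Chain.existsUnique_hom_chartScheme (locus_pullback_chartChain g')).unique
    rfl this.symm
  exact congrArg (fun f => f.left) key

lemma toChain_locus_pullback {S T : Scheme.{u}} (σ : Fin n → Fin r ↪ Fin n) (f : T ⟶ S)
    (c : PointedChain ϖ n r S) :
    (c.pullback f).toChain.locus σ = f ⁻¹ᵁ c.toChain.locus σ :=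
  Chain.locus_pullback (Over.homMk f : Over.mk (f ≫ c.hom) ⟶ Over.mk c.hom) c.toChain

/-- The base change of the chart along a chain c over S is the open locus in S where c can be framed
along σ. -/
lemma isOpenImmersion_chartMap (σ : Fin n → Fin r ↪ Fin n) :
    IsOpenImmersion.presheaf (chartMap ϖ σ) := by
  refine MorphismProperty.relative.of_exists fun S g => ?_
  obtain ⟨c, rfl⟩ := yonedaEquiv.symm.surjective g
  change PointedChain ϖ n r S at c
  let U : S.Opens := c.toChain.locus σ
  have hU : (c.pullback U.ι).toChain.locus σ = ⊤ := by
    rw [toChain_locus_pullback]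
    exact U.ι_preimage_self
  obtain ⟨φ, hφ⟩ := PointedChain.exists_hom_chartScheme hU
  refine ⟨U.toScheme, yoneda.map φ, U.ι, ?_, inferInstance⟩
  refine IsPullback.of_forall_isPullback_app fun T => ?_
  rw [Limits.Types.isPullback_iff]
  refine ⟨?_, ?_, ?_⟩
  · ext (h : T.unop ⟶ U.toScheme)
    change (chartChain ϖ σ).toPointed.pullback (h ≫ φ) = c.pullback (h ≫ U.ι)
    rw [← PointedChain.pullback_pullback, hφ, PointedChain.pullback_pullback]
  · rintro (x : T.unop ⟶ U.toScheme) (y : T.unop ⟶ U.toScheme) ⟨-, h⟩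
    exact (cancel_mono U.ι).1 h
  · intro (x : T.unop ⟶ (chartScheme ϖ σ).left) (y : T.unop ⟶ S) hxy
    change (chartChain ϖ σ).toPointed.pullback x = c.pullback y at hxy
    -- The pullback of c along y is also a pullback of the framed universal chain, so y lands in U.
    have hy : y ⁻¹ᵁ U = ⊤ := by
      rw [← toChain_locus_pullback, ← hxy, toChain_locus_pullback]
      have := (isFramed_chartChain ϖ σ).locus_eq_top
      change x ⁻¹ᵁ ((chartChain ϖ σ).locus σ) = ⊤
      rw [this]
      rfl
    have hrange : Set.range y ⊆ Set.range U.ι := by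
      rintro _ ⟨t, rfl⟩
      rw [Scheme.Opens.range_ι]
      exact hy.ge (show t ∈ ⊤ from trivial)
    refine ⟨IsOpenImmersion.lift U.ι y hrange, ?_, IsOpenImmersion.lift_fac _ _ _⟩
    change IsOpenImmersion.lift U.ι y hrange ≫ φ = x
    refine hom_chartScheme_ext ?_
    rw [← PointedChain.pullback_pullback, hφ, PointedChain.pullback_pullback,
      IsOpenImmersion.lift_fac, hxy]

/-- The loci of the various σ cover the base of any chain, and over each of them the chain comes
from the corresponding chart. -/
instance isLocallySurjective_chartMap : Presheaf.IsLocallySurjective Scheme.zariskiTopology.{u}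
    (Limits.Sigma.desc fun σ : ULift.{u} (Fin n → Fin r ↪ Fin n) =>
      chartMap (O := O) ϖ σ.down) where
  imageSieve_mem {S} c := by
    change PointedChain ϖ n r S at c
    rw [Scheme.mem_grothendieckTopology_iff]
    let 𝓤 : S.OpenCover := S.openCoverOfIsOpenCover
      (fun σ : ULift.{u} (Fin n → Fin r ↪ Fin n) => c.toChain.locus σ.down)
      (by
        refine eq_top_iff.2 fun p _ => TopologicalSpace.Opens.mem_iSup.2 ?_
        obtain ⟨σ, hσ⟩ := c.toChain.exists_mem_locus p
        exact ⟨⟨σ⟩, hσ⟩)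
    refine ⟨𝓤, ?_⟩
    rintro _ _ ⟨σ⟩
    have hU : (c.pullback (c.toChain.locus σ.down).ι).toChain.locus σ.down = ⊤ := by
      rw [toChain_locus_pullback]
      exact (c.toChain.locus σ.down).ι_preimage_self
    obtain ⟨φ, hφ⟩ := PointedChain.exists_hom_chartScheme hU
    refine ⟨(Limits.Sigma.ι (fun σ : ULift.{u} (Fin n → Fin r ↪ Fin n) =>
      yoneda.obj (chartScheme ϖ σ.down).left) σ).app _ φ, ?_⟩
    have := congrArg (fun f => f.app (op (𝓤.X σ)) φ)
      (Limits.Sigma.ι_desc (fun σ : ULift.{u} (Fin n → Fin r ↪ Fin n) =>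
        chartMap (O := O) ϖ σ.down) σ)
    exact this.trans hφ

/-- The criterion for gluing representable open subfunctors concerns sheaves on all schemes. This is
why the structure morphism to Spec O is made part of the data. -/
lemma isRepresentable_pointedLocalModel : (pointedLocalModel O ϖ n r).IsRepresentable :=
  Scheme.LocalRepresentability.isRepresentable (F := ⟨_, isSheaf_pointedLocalModel⟩)
    (f := fun σ : ULift.{u} (Fin n → Fin r ↪ Fin n) => chartMap (O := O) ϖ σ.down)
    fun σ => isOpenImmersion_chartMap σ.down

lemma PointedChain.bijective_toChain_pullback {M : Scheme.{u}} {c : PointedChain ϖ n r M}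
    (hc : ∀ T : Scheme.{u}, Function.Bijective fun f : T ⟶ M => c.pullback f)
    (T : Over (Spec (.of O))) :
    Function.Bijective fun f : T ⟶ Over.mk c.hom => c.toChain.pullback f := by
  constructor
  · intro f g hfg
    ext1
    refine (hc T.left).1 ?_
    have := congrArg Chain.toPointed hfg
    simp only [Chain.toPointed_pullback] at this
    exact this
  · intro d
    obtain ⟨f, hf⟩ := (hc T.left).2 d.toPointed
    refine ⟨Over.homMk f (congrArg PointedChain.hom hf), Chain.toPointed_injective ?_⟩
    rw [Chain.toPointed_pullback]
    exact hf

lemma Chain.pullback_pullback {U T S : Over (Spec (.of O))} (g : U ⟶ T) (f : T ⟶ S)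
    (c : Chain ϖ n r S) : c.pullback (g ≫ f) = (c.pullback f).pullback g :=
  Chain.ext (funext fun i => (c.F i).pullback_comp g.left f.left)

lemma Chain.isRepresentable_of_bijective {M : Over (Spec (.of O))} (c : Chain ϖ n r M)
    (hc : ∀ T : Over (Spec (.of O)), Function.Bijective fun f : T ⟶ M => c.pullback f) :
    (localModel O ϖ n r).IsRepresentable :=
  ⟨M, ⟨{ homEquiv := fun {T} => Equiv.ofBijective _ (hc T)
         homEquiv_comp := fun g f => c.pullback_pullback g f }⟩⟩

lemma isRepresentable_localModel : (localModel O ϖ n r).IsRepresentable := by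
  obtain ⟨M, ⟨h⟩⟩ := isRepresentable_pointedLocalModel (ϖ := ϖ) (n := n) (r := r)
  obtain ⟨c, hc⟩ : ∃ c : PointedChain ϖ n r M, ∀ (T : Scheme.{u}) (f : T ⟶ M),
      h.homEquiv f = c.pullback f := ⟨h.homEquiv (𝟙 M), fun T f => h.homEquiv_eq f⟩
  refine Chain.isRepresentable_of_bijective c.toChain
    (PointedChain.bijective_toChain_pullback fun T => ?_)
  have : (fun f : T ⟶ M => c.pullback f) = h.homEquiv := funext fun f => (hc T f).symm
  rw [this]
  exact h.homEquiv.bijective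

end

/-! ### The chart of an extreme alcove -/

lemma val_finRotate {n : ℕ} (i : Fin n) :
    (finRotate n i : ℕ) = if (i : ℕ) + 1 = n then 0 else (i : ℕ) + 1 := by
  cases n with
  | zero => exact i.elim0
  | succ m =>
    split_ifs with h
    · have : i = Fin.last m := Fin.ext (by simpa using h)
      rw [this, finRotate_last]
      rfl
    · rw [coe_finRotate_of_ne_last]
      rintro rfl
      simp at h

/-- The exponent of the uniformizer in the `(a, b)`-entry of the `i`-th frame of a chain, relative
to the entry for `i = a`. -/
def frameExponent {n : ℕ} (i a b : Fin n) : ℕ :=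
  -- The natural subtraction never truncates: if b < i and i ≤ a, then b < a.
  ((if a < i then 1 else 0) + (if b < a then 1 else 0)) - (if b < i then 1 else 0)

lemma frameExponent_self {n : ℕ} (a b : Fin n) : frameExponent a a b = 0 := by
  simp [frameExponent]

lemma frameExponent_finRotate {n : ℕ} (i a b : Fin n) :
    (if a = i then 1 else 0) + frameExponent i a b =
      (if b = i then 1 else 0) + frameExponent (finRotate n i) a b := by
  have h := val_finRotate i
  have ha := a.isLt
  have hb := b.isLt
  have hi := i.isLt
  simp only [frameExponent, Fin.lt_def, Fin.ext_iff, h]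
  split_ifs <;> omega

lemma transition_eq_pow {O : Type u} [CommRing O] (ϖ : O) {n : ℕ} (i j : Fin n) :
    transition ϖ i j = ϖ ^ (if j = i then 1 else 0) := by
  unfold transition
  split_ifs <;> simp

/-- For i ≠ a the left factor is 1, so the relation gives p_i from its cyclic successor without
dividing by q. Moving forward from i, past n - 1 to 0 if necessary, one reaches a. -/
lemma eq_pow_frameExponent_mul {A : Type u} [CommRing A] (q : A) {n : ℕ} {a b : Fin n}
    {p : Fin n → A}
    (hp : ∀ i, q ^ (if a = i then 1 else 0) * p i =
      q ^ (if b = i then 1 else 0) * p (finRotate n i)) (i : Fin n) :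
    p i = q ^ frameExponent i a b * p a := by
  have step : ∀ i, i ≠ a → p (finRotate n i) = q ^ frameExponent (finRotate n i) a b * p a →
      p i = q ^ frameExponent i a b * p a := by
    intro i hi h
    have h1 := hp i
    have h2 := frameExponent_finRotate i a b
    rw [if_neg hi.symm] at h1 h2
    rw [zero_add] at h2
    rw [h2, pow_add, mul_assoc, ← h, ← h1, pow_zero, one_mul]
  have below : ∀ (d : ℕ) (i : Fin n), (i : ℕ) + d = a →
      p i = q ^ frameExponent i a b * p a := by
    intro d
    induction d with
    | zero =>
      intro i hi
      obtain rfl : i = a := Fin.ext hi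
      rw [frameExponent_self, pow_zero, one_mul]
    | succ d ih =>
      intro i hi
      have ha := a.isLt
      refine step i (by rintro rfl; omega) (ih _ ?_)
      rw [val_finRotate, if_neg (by omega)]
      omega
  have above : ∀ (d : ℕ) (i : Fin n), a < i → (i : ℕ) + d + 1 = n →
      p i = q ^ frameExponent i a b * p a := by
    intro d
    induction d with
    | zero =>
      intro i hi hn
      -- Here i = n - 1, whose successor is 0; from there a further steps lead to a.
      refine step i hi.ne' (below a _ ?_)
      rw [val_finRotate, if_pos (by omega), zero_add]
    | succ d ih =>
      intro i hi hn
      have hr : (finRotate n i : ℕ) = i + 1 := by rw [val_finRotate, if_neg (by omega)]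
      exact step i hi.ne' (ih _ (by rw [Fin.lt_def] at *; omega) (by omega))
  rcases le_or_gt i a with h | h
  · exact below (a - i) i (by rw [Fin.le_def] at h; omega)
  · exact above (n - 1 - i) i h (by have := i.isLt; omega)

/-! ### Coordinates on the chart of a constant family σ -/

section

variable {O : Type u} [CommRing O] (ϖ : O) {n r : ℕ} {A : Type u} [CommRing A]

/-- The index set of the coordinates on the chart of an extreme alcove. -/
abbrev FrameIndex (σ : Fin r ↪ Fin n) : Type := {j : Fin n // j ∉ Set.range σ} × Fin r

open Classical in
/-- The frames of the chain with coordinates `y`. -/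
def paramFrame (q : A) (σ : Fin r ↪ Fin n) (y : FrameIndex σ → A) (i : Fin n) :
    Matrix (Fin n) (Fin r) A :=
  Matrix.of fun j k => if h : j ∈ Set.range σ then (if j = σ k then 1 else 0) else
    q ^ frameExponent i j (σ k) * y (⟨j, h⟩, k)

variable {ϖ}

lemma paramFrame_apply_self (q : A) (σ : Fin r ↪ Fin n) (y : FrameIndex σ → A)
    (x : FrameIndex σ) : paramFrame q σ y x.1 x.1 x.2 = y x := by
  rw [paramFrame, Matrix.of_apply, dif_neg x.1.2, frameExponent_self, pow_zero, one_mul]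

lemma paramFrame_map {B : Type u} [CommRing B] (ψ : A →+* B) (q : A) (σ : Fin r ↪ Fin n)
    (y : FrameIndex σ → A) (i : Fin n) :
    (paramFrame q σ y i).map ψ = paramFrame (ψ q) σ (fun x => ψ (y x)) i := by
  ext j k
  simp only [paramFrame, Matrix.map_apply, Matrix.of_apply]
  split_ifs <;> simp

lemma paramFrame_submatrix (q : A) (σ : Fin r ↪ Fin n) (y : FrameIndex σ → A) (i : Fin n) :
    (paramFrame q σ y i).submatrix σ id = 1 := by
  ext l k
  simp [paramFrame, Matrix.one_apply]

/-- With the same σ at every index, the rows occurring in the sum are rows of an identity matrix.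
Only l = k survives, and the quadratic equations become relations between single entries. -/
lemma isChart_const_iff {φ : O →+* A} {σ : Fin r ↪ Fin n}
    {P : Fin n → Matrix (Fin n) (Fin r) A} :
    IsChart ϖ φ (fun _ => σ) P ↔ (∀ i, (P i).submatrix σ id = 1) ∧
      ∀ i j k, φ ϖ ^ (if j = i then 1 else 0) * P i j k =
        φ ϖ ^ (if σ k = i then 1 else 0) * P (finRotate n i) j k := by
  refine and_congr_right fun hP => forall₃_congr fun i j k => ?_
  have hone : ∀ l k, P i (σ l) k = if l = k then 1 else 0 := fun l k => by
    have := congrFun (congrFun (hP i) l) k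
    rwa [Matrix.one_apply] at this
  have hsum : ∑ l, P (finRotate n i) j l * (φ (transition ϖ i (σ l)) * P i (σ l) k) =
      φ (transition ϖ i (σ k)) * P (finRotate n i) j k := by
    rw [Finset.sum_eq_single k (fun l _ hl => by rw [hone, if_neg hl, mul_zero, mul_zero])
      (fun h => absurd (Finset.mem_univ k) h), hone, if_pos rfl, mul_one, mul_comm]
  rw [hsum, transition_eq_pow, transition_eq_pow, map_pow, map_pow]

lemma isChart_paramFrame (φ : O →+* A) (σ : Fin r ↪ Fin n) (y : FrameIndex σ → A) :
    IsChart ϖ φ (fun _ => σ) (paramFrame (φ ϖ) σ y) := by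
  rw [isChart_const_iff]
  refine ⟨paramFrame_submatrix _ σ y, fun i j k => ?_⟩
  by_cases h : j ∈ Set.range σ
  · simp only [paramFrame, Matrix.of_apply, dif_pos h]
    by_cases hj : j = σ k
    · simp [hj]
    · simp [hj]
  · simp only [paramFrame, Matrix.of_apply, dif_neg h]
    rw [← mul_assoc, ← mul_assoc, ← pow_add, ← pow_add, frameExponent_finRotate i j (σ k)]

/-- The coordinates are the entries in row j of the frame with index i = j, where the recursion
around the cycle ends. -/
lemma IsChart.eq_paramFrame {φ : O →+* A} {σ : Fin r ↪ Fin n}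
    {P : Fin n → Matrix (Fin n) (Fin r) A} (hP : IsChart ϖ φ (fun _ => σ) P) :
    P = paramFrame (φ ϖ) σ fun x => P x.1 x.1 x.2 := by
  obtain ⟨h1, h2⟩ := isChart_const_iff.1 hP
  funext i
  ext j k
  by_cases h : j ∈ Set.range σ
  · obtain ⟨l, rfl⟩ := h
    have := congrFun (congrFun ((h1 i).trans (paramFrame_submatrix (φ ϖ) σ
      (fun x => P x.1 x.1 x.2) i).symm) l) k
    exact this
  · simp only [paramFrame, Matrix.of_apply, dif_neg h]
    exact eq_pow_frameExponent_mul (φ ϖ) (p := fun i => P i j k) (fun i => h2 i j k) i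

/-! ### Identification of U_x with affine space -/

lemma card_frameIndex (σ : Fin r ↪ Fin n) : Fintype.card (FrameIndex σ) = r * (n - r) := by
  classical
  have : Fintype.card {j : Fin n // j ∉ Set.range σ} = n - r := by
    rw [Fintype.card_subtype_compl, Fintype.card_fin, Set.card_range_of_injective σ.injective,
      Fintype.card_fin]
  rw [Fintype.card_prod, this, Fintype.card_fin, mul_comm]

/-- The numbering of the coordinates. -/
def frameIndexEquiv (σ : Fin r ↪ Fin n) : FrameIndex σ ≃ ULift.{u} (Fin (r * (n - r))) :=
  (Fintype.equivOfCardEq (by rw [card_frameIndex, Fintype.card_fin])).trans Equiv.ulift.symm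

lemma Chain.alcoveLocus_eq_locus {S : Over (Spec (.of O))} (c : Chain ϖ n r S)
    {x : Alcove n} {σ : Fin r ↪ Fin n}
    (hx : ∀ i j, (baseAlcove n).vertex i j = x.vertex i j ↔ j ∉ Set.range σ) :
    c.alcoveLocus x = c.locus fun _ => σ := by
  ext p
  refine forall_congr' fun i => ?_
  refine Iff.trans ?_ Subsheaf.mem_locus.symm
  refine exists_congr fun W => ?_
  have := sup_span_eq_top_iff ((c.F i).sections W) σ
    {j | (baseAlcove n).vertex i j = x.vertex i j} fun j => hx i j
  refine (and_congr_right fun _ => this).trans ?_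
  exact exists_and_left.symm

/-- The difference x_i - ω_i is w(μ) for every i. Its support, the image under w of the first r
indices, is the range of σ. -/
lemma Alcove.IsExtreme.exists_embedding (hrn : r ≤ n) {x : Alcove n} (hx : x.IsExtreme r) :
    ∃ σ : Fin r ↪ Fin n,
      ∀ i j, (baseAlcove n).vertex i j = x.vertex i j ↔ j ∉ Set.range σ := by
  obtain ⟨w, rfl⟩ := hx
  refine ⟨(Fin.castLEEmb hrn).trans w.toEmbedding, fun i j => ?_⟩
  have hmem : j ∈ Set.range ((Fin.castLEEmb hrn).trans w.toEmbedding) ↔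
      ((w⁻¹ j : Fin n) : ℕ) < r := by
    constructor
    · rintro ⟨l, rfl⟩
      simp
    · intro h
      exact ⟨⟨_, h⟩, by simp⟩
  rw [hmem]
  simp [Alcove.translate, mu]

lemma smooth_affineSpace (R : Type u) [CommRing R] (ι : Type u) [Finite ι] :
    Smooth (AffineSpace ι (Spec (.of R)) ↘ Spec (.of R)) := by
  have hC : Smooth (Spec.map (CommRingCat.ofHom (MvPolynomial.C : R →+* MvPolynomial ι R))) := by
    rw [HasRingHomProperty.Spec_iff (P := @Smooth)]
    change RingHom.Smooth (algebraMap R (MvPolynomial ι R))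
    rw [RingHom.smooth_algebraMap]
    constructor <;> infer_instance
  rw [← Iso.hom_inv_id_assoc (AffineSpace.SpecIso ι (.of R))
    (AffineSpace ι (Spec (.of R)) ↘ Spec (.of R)), AffineSpace.SpecIso_inv_over]
  exact AlgebraicGeometry.smooth_comp _ _

/-- Both sides have the same points: over U the universal chain is described by its diagonal
entries, and every choice of coordinates defines a framed chain. -/
lemma exists_locus_iso {M : Over (Spec (.of O))} (h : (localModel O ϖ n r).RepresentableBy M)
    (σ : Fin r ↪ Fin n) {U : M.left.Opens}
    (hU : U = Chain.locus (h.homEquiv (𝟙 M) : Chain ϖ n r M) fun _ => σ) :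
    Nonempty (Over.mk (U.ι ≫ M.hom) ≅
      Over.mk (AffineSpace (ULift.{u} (Fin (r * (n - r)))) (Spec (.of O)) ↘ Spec (.of O))) := by
  obtain ⟨c, hc⟩ : ∃ c : Chain ϖ n r M, c = h.homEquiv (𝟙 M) := ⟨_, rfl⟩
  rw [← hc] at hU
  have hinj : ∀ {T : Over (Spec (.of O))} {f g : T ⟶ M}, c.pullback f = c.pullback g → f = g := by
    intro T f g hfg
    apply h.homEquiv.injective
    rw [h.homEquiv_eq f, h.homEquiv_eq g, ← hc]
    exact hfg
  have hsurj : ∀ {T : Over (Spec (.of O))} (d : Chain ϖ n r T),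
      ∃ f : T ⟶ M, c.pullback f = d := by
    intro T d
    refine ⟨h.homEquiv.symm d, ?_⟩
    rw [hc]
    exact (h.homEquiv_eq (h.homEquiv.symm d)).symm.trans (h.homEquiv.apply_symm_apply d)
  let e := frameIndexEquiv.{u} σ
  let UO : Over (Spec (.of O)) := Over.mk (U.ι ≫ M.hom)
  let AO : Over (Spec (.of O)) :=
    Over.mk (AffineSpace (ULift.{u} (Fin (r * (n - r)))) (Spec (.of O)) ↘ Spec (.of O))
  let j : UO ⟶ M := Over.homMk U.ι
  have hj : (c.pullback j).locus (fun _ => σ) = ⊤ := by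
    rw [Chain.locus_pullback, ← hU]
    exact U.ι_preimage_self
  obtain ⟨P, hP⟩ := Chain.exists_isFramed hj
  let p : UO ⟶ AO := Over.homMk
    (AffineSpace.homOfVector (U.ι ≫ M.hom) fun a =>
      P (e.symm a).1 (e.symm a).1 (e.symm a).2) (AffineSpace.homOfVector_over _ _)
  have hp : ∀ a, (p.left.appLE ⊤ ⊤ (le_preimage_top _ _)).hom
      (AffineSpace.coord (Spec (.of O)) a) = P (e.symm a).1 (e.symm a).1 (e.symm a).2 := by
    intro a
    rw [appLE_top_top]
    exact AffineSpace.homOfVector_appTop_coord _ _ a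
  -- This is the chain over affine space whose parameters are the coordinate functions. Being framed
  -- along σ everywhere, it is classified by a map into U.
  obtain ⟨d, hd⟩ := (isChart_paramFrame (ϖ := ϖ) (scalar AO ⊤) σ
    fun x => AffineSpace.coord (Spec (.of O)) (e x)).exists_isFramed
  obtain ⟨f, hf⟩ := hsurj d
  have hfU : Set.range f.left ⊆ Set.range U.ι := by
    rintro _ ⟨t, rfl⟩
    rw [Scheme.Opens.range_ι]
    have := hd.locus_eq_top
    rw [← hf, Chain.locus_pullback, ← hU] at this
    exact this.ge (show t ∈ ⊤ from trivial)
  let q : AO ⟶ UO := Over.homMk (IsOpenImmersion.lift U.ι f.left hfU) (by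
    change IsOpenImmersion.lift U.ι f.left hfU ≫ U.ι ≫ M.hom = _
    rw [IsOpenImmersion.lift_fac_assoc, Over.w])
  have hqj : q ≫ j = f := by
    ext1
    exact IsOpenImmersion.lift_fac _ _ _
  have hqd : (c.pullback j).pullback q = d := by
    rw [← Chain.pullback_pullback, hqj, hf]
  refine ⟨⟨p, q, ?_, ?_⟩⟩
  -- Since j is a monomorphism, it suffices to compare the chains classified by the two maps to M,
  -- and these have the same frame.
  · have : (p ≫ q) ≫ j = 𝟙 _ ≫ j := by
      refine hinj ?_
      rw [Category.assoc, hqj, Category.id_comp, Chain.pullback_pullback, hf]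
      refine Chain.IsFramed.eq (P := P) ?_ hP
      have h1 := hd.pullback p
      convert h1 using 1
      refine hP.isChart.eq_paramFrame.trans ?_
      funext i
      rw [paramFrame_map, appLE_scalar]
      congr 1
      funext x
      rw [hp, Equiv.symm_apply_apply]
    have h2 := congrArg (fun g => g.left) this
    ext1
    exact (cancel_mono U.ι).1 h2
  -- A map to affine space is determined by its structure morphism and coordinates. The latter are
  -- read off from the unique frame of d at its diagonal entries.
  · ext1
    refine AffineSpace.hom_ext ?_ fun a => ?_
    · exact (Over.w (q ≫ p)).trans (Over.w (𝟙 AO)).symm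
    · have h1 := hP.pullback q
      rw [hqd] at h1
      have h2 := congrFun (congrFun (congrFun (h1.unique hd) (e.symm a).1) (e.symm a).1)
        (e.symm a).2
      rw [paramFrame_apply_self, Equiv.apply_symm_apply] at h2
      have h3 : (q ≫ p).left.appTop.hom (AffineSpace.coord (Spec (.of O)) a) =
          (q.left.appLE ⊤ ⊤ (le_preimage_top _ _)).hom
            ((p.left.appLE ⊤ ⊤ (le_preimage_top _ _)).hom
              (AffineSpace.coord (Spec (.of O)) a)) := by
        rw [appLE_top_top, appLE_top_top, Over.comp_left, Scheme.Hom.comp_appTop]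
        rfl
      refine h3.trans ?_
      rw [hp]
      refine Eq.trans h2 ?_
      simp

end

end LocalModel

end

theorem mainTheorem11 {O : Type u} [CommRing O] [IsDomain O] [IsDiscreteValuationRing O]
    [IsAdicComplete (IsLocalRing.maximalIdeal O) O] [PerfectField (IsLocalRing.ResidueField O)]
    (ϖ : O) (hϖ : Irreducible ϖ) (n r : ℕ) (hr : 0 < r) (hrn : r < n) :
    (LocalModel.localModel O ϖ n r).IsRepresentable ∧
    ∀ (M : Over (Spec (.of O))) (h : (LocalModel.localModel O ϖ n r).RepresentableBy M)
      (x : LocalModel.Alcove n), x.IsExtreme r →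
      (∃ e : (LocalModel.openSubset h x).toScheme ≅
          AffineSpace (ULift.{u} (Fin (r * (n - r)))) (Spec (.of O)),
        e.hom ≫ (AffineSpace (ULift.{u} (Fin (r * (n - r)))) (Spec (.of O)) ↘ Spec (.of O)) =
          (LocalModel.openSubset h x).ι ≫ M.hom) ∧
      Smooth ((LocalModel.openSubset h x).ι ≫ M.hom) := by
  refine ⟨LocalModel.isRepresentable_localModel, fun M h x hx => ?_⟩
  obtain ⟨σ, hσ⟩ := hx.exists_embedding hrn.le
  obtain ⟨i⟩ := LocalModel.exists_locus_iso h σ (LocalModel.Chain.alcoveLocus_eq_locus _ hσ)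
  have hi : i.hom.left ≫
      (AffineSpace (ULift.{u} (Fin (r * (n - r)))) (Spec (.of O)) ↘ Spec (.of O)) =
        (LocalModel.openSubset h x).ι ≫ M.hom := Over.w i.hom
  refine ⟨⟨(Over.forget _).mapIso i, hi⟩, ?_⟩
  have := LocalModel.smooth_affineSpace O (ULift.{u} (Fin (r * (n - r))))
  have : IsIso i.hom.left := inferInstanceAs (IsIso ((Over.forget _).map i.hom))
  rw [← hi]
  exact AlgebraicGeometry.smooth_comp i.hom.left _
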